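/- **Definitions.** A *ring* is a pair of concentric circles in the plane with outer radius $R>0$ and signed inner radius $r$, $|r|<R$; the sign of $r$ is an orientation (positive: counter-clockwise, negative: clockwise), and $r=0$ is allowed (a point circle). An *orthogonal ring pattern* on $\mathbb Z^2$ assigns to each vertex $v=(m,n)$ a ring with circles $c_v, C_v$ (inner, outer), such that (1) for neighbouring $v,w$ the circle $C_v$ meets $c_w$ orthogonally and $c_v$ meets $C_w$ orthogonally; (2) in each unit square with lower left corner $(m,n)$ the circles $c_{m,n}, c_{m+1,n+1}, C_{m+1,n}, C_{m,n+1}$ pass through one point $t_{m,n}$, where the two inner circles touch and the two outer circles touch (touching circles of equal orientation lie on different sides of the common tangent, circles of opposite orientation on the same side; outer circles count as positively oriented); (3) for the corner $v=(m,n)$ of the square with neighbours $v_1=(m+1,n)$, $v_2=(m,n+1)$, and likewise for $v=(m+1,n+1)$, $v_1=(m,n+1)$, $v_2=(m+1,n)$, the points $c_v\cap C_{v_1}\setminus C_{v_2}$, $t_{m,n}$, $c_v\cap C_{v_2}\setminus C_{v_1}$ are in counter-clockwise order if $r_v>0$ and in clockwise order if $r_v<0$; for the other two corners the same holds with the roles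 of inner and outer circles interchanged, the order being given by the orientation of $c_{v_1},c_{v_2}$ when these two orientations agree. The pattern has *$\rho$-radii* $\rho_v$ (and ring area $\pi\ell^2$, $\ell>0$) if $R_v=\ell\cosh\rho_v$ and $r_v=\ell\sinh\rho_v$ for all $v$. The *cyclic quadrilateral* of an edge $vw$ has as vertices the centres of the rings at $v$, $w$ and the points $t$ of the two squares containing the edge; $\varphi_{v,w}\in(-\pi,\pi]$ denotes its oriented angle at $v$, measured from the point $t$ on the right of the edge (seen from $v$ to $w$ in $\mathbb Z^2$) to the one on the left. An *orthogonal circle pattern* on $\mathbb Z^2$ (Schramm) is defined in the same way with one positively oriented circle of positive radius per vertex and the orientation condition at all four corners of each square; a *dual* of it is an orthogonal circle pattern with the reciprocal radii. **Proposition (Doyle spiral ring pattern).** Let $x,y\in\mathbb R$ with $x+iy\neq0$, put $\rho_{m,n}=mx-ny$, and for $\delta\in\mathbb R$ put $\rho^\delta_{m,n}=\rho_{m,n}+\delta$. (a) For every $\ell>0$ and $\delta\in\mathbb R$ (in particular $\delta=0$) there is an orthogonal ring pattern on $\mathbb Z^2$ with $\rho$-radii $\rho^\delta_{m,n}$ and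 ring area $\pi\ell^2$, and it is unique up to orientation preserving Euclidean motions. (b) In each such pattern, at every vertex $v=(m,n)$ with $\rho^\delta_{m,n}>0$ one has $$\varphi_{v,(m\pm1,n)}=\pi-2\arctan(e^{\mp x}),\qquad \varphi_{v,(m,n\pm1)}=\pi-2\arctan(e^{\pm y}),$$ and at every vertex with $\rho^\delta_{m,n}<0$ $$\varphi_{v,(m\pm1,n)}=-2\arctan(e^{\mp x}),\qquad \varphi_{v,(m,n\pm1)}=-2\arctan(e^{\pm y}).$$ In particular, for $\delta=0$ the angles are constant along horizontal and along vertical edges in each of the half-planes $mx>ny$ and $mx<ny$. (c) Let $\mathcal R^\delta$ be the pattern with $\rho$-radii $\rho^\delta_{m,n}$ and ring area $\pi$, placed with the centre of the ring at $(0,0)$ at the origin and that of the ring at $(1,0)$ on the positive real axis. Its centres, radii and points $t_{m,n}$ depend continuously on $\delta$. The centres, signed inner radii, outer radii and points $t_{m,n}$ of the scaled patterns $2e^{-|\delta|}\mathcal R^\delta$ converge, as $\delta\to+\infty$, to those of a Doyle spiral $\mathcal C$, i.e. an orthogonal circle pattern with radii $|e^{(x+iy)(m+in)}|=e^{\rho_{m,n}}$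 (both radii tending to $e^{\rho_{m,n}}$), and, as $\delta\to-\infty$, to those of a dual pattern $\mathcal C^*$ of $\mathcal C$ with opposite orientation, i.e. to the mirror image of an orthogonal circle pattern with radii $e^{-\rho_{m,n}}$, with the signed inner radii tending to $-e^{-\rho_{m,n}}$ and the outer radii to $e^{-\rho_{m,n}}$. -/

import Mathlib

open Filter Topology

/-- `a, b, c` are in counter-clockwise (clockwise) order iff `orient a b c` is positive (negative):
twice the signed area of the triangle. -/
noncomputable def orient (a b c : ℂ) : ℝ :=
  ((starRingEnd ℂ) (b - a) * (c - a)).im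

/-- The circle with centre `p` and signed radius `r`, as a point set. The sign of `r` is
an orientation; for `r = 0` the circle is a point. -/
def circle (p : ℂ) (r : ℝ) : Set ℂ := Metric.sphere p |r|

/-- The circles intersect orthogonally: at a common point the radii are perpendicular.
(A point circle is orthogonal to a circle iff it lies on it.) -/
def OrthogonalCircles (p₁ : ℂ) (r₁ : ℝ) (p₂ : ℂ) (r₂ : ℝ) : Prop :=
  ∃ q ∈ circle p₁ r₁ ∩ circle p₂ r₂, inner ℝ (q - p₁) (q - p₂) = 0

/-- The oriented circles pass through `t` and touch there. If their orientations agree, the centres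
lie on different sides of the common tangent; if they differ, on the same side. -/
def TouchAt (p₁ : ℂ) (r₁ : ℝ) (p₂ : ℂ) (r₂ : ℝ) (t : ℂ) : Prop :=
  t ∈ circle p₁ r₁ ∩ circle p₂ r₂ ∧ (r₁ : ℂ) * (t - p₂) = -((r₂ : ℂ) * (t - p₁))

/-- The points `c ∩ c₁ \ c₂`, `t`, `c ∩ c₂ \ c₁` are in counter-clockwise order if `0 < s` and in
clockwise order if `s < 0`. -/
def TripleOriented (c c₁ c₂ : Set ℂ) (t : ℂ) (s : ℝ) : Prop :=
  ∀ a ∈ (c ∩ c₁) \ c₂, ∀ b ∈ (c ∩ c₂) \ c₁,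
    (0 < s → 0 < orient a t b) ∧ (s < 0 → orient a t b < 0)

/-- Rings indexed by the vertices of `ℤ²`: common centre, signed inner radius, outer radius.
`touch m n` is the touching point that belongs to the unit square with lower left
vertex `(m, n)`. -/
@[ext]
structure RingSystem where
  center : ℤ → ℤ → ℂ
  inner : ℤ → ℤ → ℝ
  outer : ℤ → ℤ → ℝ
  touch : ℤ → ℤ → ℂ

namespace RingSystem

/-- The inner circle at `(m, n)`. -/
def innerCircle (P : RingSystem) (m n : ℤ) : Set ℂ := circle (P.center m n) (P.inner m n)

/-- The outer circle at `(m, n)`. -/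
def outerCircle (P : RingSystem) (m n : ℤ) : Set ℂ := circle (P.center m n) (P.outer m n)

/-- The rings at the vertices `(m, n)` and `(m', n')` intersect orthogonally. -/
def OrthogonalRings (P : RingSystem) (m n m' n' : ℤ) : Prop :=
  OrthogonalCircles (P.center m n) (P.outer m n) (P.center m' n') (P.inner m' n') ∧
  OrthogonalCircles (P.center m n) (P.inner m n) (P.center m' n') (P.outer m' n')

/-- Orthogonal ring patterns on the whole `ℤ²` lattice. -/
structure IsOrthogonalRingPattern (P : RingSystem) : Prop where
  /-- Every pair of circles bounds an annulus; the outer radius is positive. -/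
  ring : ∀ m n, |P.inner m n| < P.outer m n
  /-- Rings at neighbouring vertices intersect orthogonally. -/
  orthogonal_horizontal : ∀ m n, P.OrthogonalRings m n (m + 1) n
  orthogonal_vertical : ∀ m n, P.OrthogonalRings m n m (n + 1)
  /-- In each square the inner circles of one diagonal and the outer circles of the other diagonal
  pass through one point and touch there. -/
  touch_inner : ∀ m n, TouchAt (P.center m n) (P.inner m n)
    (P.center (m + 1) (n + 1)) (P.inner (m + 1) (n + 1)) (P.touch m n)
  touch_outer : ∀ m n, TouchAt (P.center (m + 1) n) (P.outer (m + 1) n)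
    (P.center m (n + 1)) (P.outer m (n + 1)) (P.touch m n)
  /-- Orientation on the inner circle of a vertex, for two neighbours (listed counter-clockwise in
  `ℤ²`) in a common square whose outer circles touch on that inner circle. -/
  orient_lower_left : ∀ m n, TripleOriented (P.innerCircle m n)
    (P.outerCircle (m + 1) n) (P.outerCircle m (n + 1)) (P.touch m n) (P.inner m n)
  orient_upper_right : ∀ m n, TripleOriented (P.innerCircle (m + 1) (n + 1))
    (P.outerCircle m (n + 1)) (P.outerCircle (m + 1) n) (P.touch m n) (P.inner (m + 1) (n + 1))
  /-- The same with inner and outer circles interchanged; the order on the outer circle is given by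
  the orientation of the two inner circles, when these agree. -/
  orient_lower_right_pos : ∀ m n, 0 < P.inner (m + 1) (n + 1) → 0 < P.inner m n →
    TripleOriented (P.outerCircle (m + 1) n)
      (P.innerCircle (m + 1) (n + 1)) (P.innerCircle m n) (P.touch m n) 1
  orient_lower_right_neg : ∀ m n, P.inner (m + 1) (n + 1) < 0 → P.inner m n < 0 →
    TripleOriented (P.outerCircle (m + 1) n)
      (P.innerCircle (m + 1) (n + 1)) (P.innerCircle m n) (P.touch m n) (-1)
  orient_upper_left_pos : ∀ m n, 0 < P.inner m n → 0 < P.inner (m + 1) (n + 1) →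
    TripleOriented (P.outerCircle m (n + 1))
      (P.innerCircle m n) (P.innerCircle (m + 1) (n + 1)) (P.touch m n) 1
  orient_upper_left_neg : ∀ m n, P.inner m n < 0 → P.inner (m + 1) (n + 1) < 0 →
    TripleOriented (P.outerCircle m (n + 1))
      (P.innerCircle m n) (P.innerCircle (m + 1) (n + 1)) (P.touch m n) (-1)

/-- The rings have `ρ`-radii `ρ` and area `π ℓ²`. -/
def HasRhoRadii (P : RingSystem) (ℓ : ℝ) (ρ : ℤ → ℤ → ℝ) : Prop :=
  ∀ m n, P.outer m n = ℓ * Real.cosh (ρ m n) ∧ P.inner m n = ℓ * Real.sinh (ρ m n)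

/-- Position of a pattern in the plane: the ring at `(0, 0)` is centred at the origin, the one
at `(1, 0)` on the positive real axis. -/
def Normalized (P : RingSystem) : Prop :=
  P.center 0 0 = 0 ∧ 0 < (P.center 1 0).re ∧ (P.center 1 0).im = 0

/-- `Q` is the image of `P` under an orientation preserving Euclidean motion. -/
def Congruent (P Q : RingSystem) : Prop :=
  Q.inner = P.inner ∧ Q.outer = P.outer ∧ ∃ a b : ℂ, ‖a‖ = 1 ∧
    ∀ m n, Q.center m n = a * P.center m n + b ∧ Q.touch m n = a * P.touch m n + b

/-- The oriented angle at `p` from `a` to `b`, in `(-π, π]`. -/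
noncomputable def angleAt (p a b : ℂ) : ℝ := Complex.arg ((b - p) / (a - p))

/- The cyclic quadrilateral of an edge has as vertices the two ring centres and the touching points
of the two squares that contain the edge. The four angles below are those at the vertex `(m, n)` in
the quadrilaterals of the edges to its four neighbours. They are measured from the touching point
on the right to the touching point on the left of the edge, seen from `(m, n)`. -/

/-- Angle at `(m, n)` for the horizontal edge to `(m + 1, n)`. -/
noncomputable def angleEast (P : RingSystem) (m n : ℤ) : ℝ :=
  angleAt (P.center m n) (P.touch m (n - 1)) (P.touch m n)

/-- Angle at `(m, n)` for the vertical edge to `(m, n + 1)`. -/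
noncomputable def angleNorth (P : RingSystem) (m n : ℤ) : ℝ :=
  angleAt (P.center m n) (P.touch m n) (P.touch (m - 1) n)

/-- Angle at `(m, n)` for the horizontal edge to `(m - 1, n)`. -/
noncomputable def angleWest (P : RingSystem) (m n : ℤ) : ℝ :=
  angleAt (P.center m n) (P.touch (m - 1) n) (P.touch (m - 1) (n - 1))

/-- Angle at `(m, n)` for the vertical edge to `(m, n - 1)`. -/
noncomputable def angleSouth (P : RingSystem) (m n : ℤ) : ℝ :=
  angleAt (P.center m n) (P.touch (m - 1) (n - 1)) (P.touch m (n - 1))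

/-- The pattern scaled by the factor `s`. -/
noncomputable def scale (s : ℝ) (P : RingSystem) : RingSystem where
  center m n := (s : ℂ) * P.center m n
  inner m n := s * P.inner m n
  outer m n := s * P.outer m n
  touch m n := (s : ℂ) * P.touch m n

/-- Convergence of all centres, radii and touching points. -/
def Converges (F : ℝ → RingSystem) (l : Filter ℝ) (Q : RingSystem) : Prop :=
  ∀ m n, Tendsto (fun δ => (F δ).center m n) l (𝓝 (Q.center m n)) ∧
    Tendsto (fun δ => (F δ).inner m n) l (𝓝 (Q.inner m n)) ∧
    Tendsto (fun δ => (F δ).outer m n) l (𝓝 (Q.outer m n)) ∧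
    Tendsto (fun δ => (F δ).touch m n) l (𝓝 (Q.touch m n))

/-- All centres, radii and touching points depend continuously on the parameter. -/
def ContinuousFamily (F : ℝ → RingSystem) : Prop :=
  ∀ m n, Continuous (fun δ => (F δ).center m n) ∧ Continuous (fun δ => (F δ).inner m n) ∧
    Continuous (fun δ => (F δ).outer m n) ∧ Continuous (fun δ => (F δ).touch m n)

end RingSystem

/-- Circles indexed by the vertices of `ℤ²`, and the point `touch m n` of the square with
lower left vertex `(m, n)`. -/
structure CircleSystem where
  center : ℤ → ℤ → ℂ
  radius : ℤ → ℤ → ℝ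
  touch : ℤ → ℤ → ℂ

namespace CircleSystem

/-- The circle at `(m, n)`. -/
def circleAt (C : CircleSystem) (m n : ℤ) : Set ℂ := circle (C.center m n) (C.radius m n)

/-- Schramm's orthogonal circle patterns on `ℤ²`: neighbouring circles intersect orthogonally,
the circles of each diagonal of a square touch, all four in one point, and for each vertex and
any two consecutive neighbours the intersection points are in counter-clockwise order. -/
structure IsOrthogonalCirclePattern (C : CircleSystem) : Prop where
  radius_pos : ∀ m n, 0 < C.radius m n
  orthogonal_horizontal : ∀ m n, OrthogonalCircles (C.center m n) (C.radius m n)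
    (C.center (m + 1) n) (C.radius (m + 1) n)
  orthogonal_vertical : ∀ m n, OrthogonalCircles (C.center m n) (C.radius m n)
    (C.center m (n + 1)) (C.radius m (n + 1))
  touch_diagonal : ∀ m n, C.circleAt m n ∩ C.circleAt (m + 1) (n + 1) = {C.touch m n}
  touch_antidiagonal : ∀ m n, C.circleAt (m + 1) n ∩ C.circleAt m (n + 1) = {C.touch m n}
  orient_lower_left : ∀ m n, TripleOriented (C.circleAt m n)
    (C.circleAt (m + 1) n) (C.circleAt m (n + 1)) (C.touch m n) 1
  orient_lower_right : ∀ m n, TripleOriented (C.circleAt (m + 1) n)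
    (C.circleAt (m + 1) (n + 1)) (C.circleAt m n) (C.touch m n) 1
  orient_upper_right : ∀ m n, TripleOriented (C.circleAt (m + 1) (n + 1))
    (C.circleAt m (n + 1)) (C.circleAt (m + 1) n) (C.touch m n) 1
  orient_upper_left : ∀ m n, TripleOriented (C.circleAt m (n + 1))
    (C.circleAt m n) (C.circleAt (m + 1) (n + 1)) (C.touch m n) 1

/-- `D` is a dual of `C`: both are orthogonal circle patterns, with reciprocal radii. -/
def IsDual (D C : CircleSystem) : Prop :=
  D.IsOrthogonalCirclePattern ∧ C.IsOrthogonalCirclePattern ∧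
    ∀ m n, D.radius m n = (C.radius m n)⁻¹

/-- A circle pattern as a system of rings of area zero. -/
def toRings (C : CircleSystem) : RingSystem where
  center := C.center
  inner := C.radius
  outer := C.radius
  touch := C.touch

/-- The circle pattern with opposite orientation (its mirror image, with negative inner radii)
as a system of rings of area zero. -/
def toReversedRings (C : CircleSystem) : RingSystem where
  center m n := (starRingEnd ℂ) (C.center m n)
  inner m n := -C.radius m n
  outer := C.radius
  touch m n := (starRingEnd ℂ) (C.touch m n)

/-- Schramm's Doyle spiral: an orthogonal circle pattern with radii `|exp ((x + iy)(m + in))|`. -/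
def IsDoyleSpiral (C : CircleSystem) (x y : ℝ) : Prop :=
  C.IsOrthogonalCirclePattern ∧ ∀ m n : ℤ, C.radius m n =
    ‖Complex.exp (((x : ℂ) + (y : ℂ) * Complex.I) * ((m : ℂ) + (n : ℂ) * Complex.I))‖

end CircleSystem

/-- The `ρ`-radii of the Doyle spiral ring pattern. -/
def doyleRho (x y : ℝ) (m n : ℤ) : ℝ := m * x - n * y

/-! ### Circles, motions and the orientation condition -/

open Complex (I)

/-! In each square, touching and orthogonality put the four centres on two perpendicular lines
through the touching point `t`: the two corners with inner circles lie on the line with direction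
`u`, the two with outer circles on the line with direction `i u`. What remains open is the side on
which a corner of the first kind lies, and the orientation condition settles it. A ring pattern is
therefore a solution of the linear equations `IsFrame` with unit directions `u` and `|r| < R`
(`exists_frame` and `IsFrame.isOrthogonalRingPattern`). Evaluating an edge in the two squares that
share it shows that the radii determine how `u` turns from square to square, so they determine the
pattern up to a motion (`IsFrame.eq_move`).

For the radii `e^ρ` of a Doyle spiral, `u` turns by a constant unit factor `doyleRatio` in each
lattice direction, and the centres form geometric progressions (`isFrame_doyle`). The mirror image
of the spiral with radii `e^(-ρ)` has the same directions `u`. Since the frame equations are linear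
for fixed `u`, the two can be superposed; the coefficients `ℓ e^δ / 2` and `ℓ e^(-δ) / 2` produce
exactly `ℓ sinh (ρ + δ)` and `ℓ cosh (ρ + δ)` (`isFrame_doyleRing`). By uniqueness every pattern
with these radii is this one, up to a motion. The angles are arguments of a turning factor times `i`
and a real number with the sign of the inner radius, and as `δ → ±∞` one of the two summands
dominates. -/

theorem mem_circle_iff {p z : ℂ} {r : ℝ} :
    z ∈ circle p r ↔ (z.re - p.re) ^ 2 + (z.im - p.im) ^ 2 = r ^ 2 := by
  have h : ‖z - p‖ ^ 2 = (z.re - p.re) ^ 2 + (z.im - p.im) ^ 2 := by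
    rw [← Complex.normSq_eq_norm_sq, Complex.normSq_apply]
    simp; ring
  rw [circle, mem_sphere_iff_norm, ← h, ← sq_abs r]
  constructor
  · intro h; rw [h]
  · intro h; exact (sq_eq_sq₀ (norm_nonneg _) (abs_nonneg _)).1 h

theorem circle_neg (p : ℂ) (r : ℝ) : circle p (-r) = circle p r := by
  simp [circle]

/-- Multiplication by a unit complex number and translation preserve circles. -/
theorem add_mul_mem_circle_iff {u : ℂ} (hu : ‖u‖ = 1) (t z p : ℂ) (r : ℝ) :
    t + u * z ∈ circle (t + u * p) r ↔ z ∈ circle p r := by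
  simp only [circle, mem_sphere_iff_norm]
  rw [show t + u * z - (t + u * p) = u * (z - p) by ring, norm_mul, hu, one_mul]

theorem orient_add_mul {u : ℂ} (hu : ‖u‖ = 1) (t a b c : ℂ) :
    orient (t + u * a) (t + u * b) (t + u * c) = orient a b c := by
  have h : (starRingEnd ℂ) u * u = 1 := by
    rw [← Complex.normSq_eq_conj_mul_self, Complex.normSq_eq_norm_sq, hu]; simp
  unfold orient
  congr 1
  rw [show t + u * b - (t + u * a) = u * (b - a) by ring,
    show t + u * c - (t + u * a) = u * (c - a) by ring, map_mul]
  linear_combination ((starRingEnd ℂ) (b - a) * (c - a)) * h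

theorem exists_eq_add_mul {u : ℂ} (hu : ‖u‖ = 1) (t a : ℂ) : ∃ z, a = t + u * z := by
  have : u ≠ 0 := by rintro rfl; simp at hu
  exact ⟨(a - t) / u, by field_simp; ring⟩

/-- A circle through `0` centred on the real axis, and two circles touching at `0` from opposite
sides of the real axis. -/
theorem tripleOriented_zero {s k R₁ R₂ : ℝ} (h₁ : 0 < R₁) (h₂ : 0 < R₂)
    (hk : 0 < k) :
    TripleOriented (circle (-s) s) (circle (-I * R₁) R₁) (circle (I * R₂) R₂) 0 (k * s) := by
  rintro z ⟨⟨hz, hz₁⟩, hz₂⟩ w ⟨⟨hw, hw₂⟩, hw₁⟩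
  rw [mem_circle_iff] at *
  simp at hz hz₁ hz₂ hw hw₁ hw₂
  have ho : orient z 0 w = z.im * w.re - z.re * w.im := by
    simp [orient]; ring
  -- The difference of two circle equations is their radical axis, a line through `0`.
  have ez : s * z.re = R₁ * z.im := by linear_combination (hz - hz₁) / 2
  have ew : s * w.re = - (R₂ * w.im) := by linear_combination (hw - hw₂) / 2
  -- The third circle passes through `0`, so a point off it is not `0`. The equation of the first
  -- circle, `|z|² = -2 s Re z`, then fixes the sign of `s Re z`.
  have hz0 : 0 < z.re ^ 2 + z.im ^ 2 := by
    by_contra! h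
    have h1 : z.re = 0 := by nlinarith [sq_nonneg z.re, sq_nonneg z.im]
    have h2 : z.im = 0 := by nlinarith [sq_nonneg z.re, sq_nonneg z.im]
    simp [h1, h2] at hz₂
  have hw0 : 0 < w.re ^ 2 + w.im ^ 2 := by
    by_contra! h
    have h1 : w.re = 0 := by nlinarith [sq_nonneg w.re, sq_nonneg w.im]
    have h2 : w.im = 0 := by nlinarith [sq_nonneg w.re, sq_nonneg w.im]
    simp [h1, h2] at hw₁
  have sz : s * z.re < 0 := by nlinarith
  have sw : s * w.re < 0 := by nlinarith
  have hzw : 0 < z.re * w.re := by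
    have := mul_pos_of_neg_of_neg sz sw
    by_contra! h
    nlinarith [mul_nonneg (sq_nonneg s) (neg_nonneg.2 h)]
  have key : orient z 0 w * (R₁ * R₂) = s * (z.re * w.re * (R₁ + R₂)) := by
    rw [ho]; linear_combination (-R₂ * w.re) * ez - R₁ * z.re * ew
  have hR := mul_pos h₁ h₂
  have hM := mul_pos hzw (add_pos h₁ h₂)
  constructor
  · intro h
    have hs : 0 < s := by by_contra! h'; nlinarith
    have := mul_pos hs hM
    by_contra! h'; nlinarith
  · intro h
    have hs : s < 0 := by by_contra! h'; nlinarith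
    have := mul_neg_of_neg_of_pos hs hM
    by_contra! h'; nlinarith

/-- The orientation condition at the corner `t - s u` of a kite-shaped square. -/
theorem tripleOriented_of_frame {u : ℂ} (hu : ‖u‖ = 1) {s k R₁ R₂ : ℝ} (t : ℂ) (h₁ : 0 < R₁)
    (h₂ : 0 < R₂) (hk : 0 < k) :
    TripleOriented (circle (t - s * u) s) (circle (t - I * R₁ * u) R₁)
      (circle (t + I * R₂ * u) R₂) t (k * s) := by
  intro a ha b hb
  obtain ⟨z, rfl⟩ := exists_eq_add_mul hu t a
  obtain ⟨w, rfl⟩ := exists_eq_add_mul hu t b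
  rw [show t - s * u = t + u * (-s) by ring, show t - I * R₁ * u = t + u * (-I * R₁) by ring,
    show t + I * R₂ * u = t + u * (I * R₂) by ring] at ha hb
  simp only [Set.mem_sdiff, Set.mem_inter_iff, add_mul_mem_circle_iff hu] at ha hb
  have := orient_add_mul hu t z 0 w
  rw [mul_zero, add_zero] at this
  rw [this]
  exact tripleOriented_zero h₁ h₂ hk z ha w hb

/-- The orientation condition quantifies over all second intersection points, so refuting it
requires that such points exist. They are the reflections of `0` in the lines joining the centres;
the positive quantity `hp` is the power of such a point with respect to the third circle. -/
theorem exists_mem_diff_zero {s R₁ R₂ : ℝ} (hs : s ≠ 0) (h₁ : 0 < R₁) (h₂ : 0 < R₂) :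
    (∃ z, z ∈ (circle (-s) s ∩ circle (-I * R₁) R₁) \ circle (I * R₂) R₂) ∧
    (∃ z, z ∈ (circle (-s) s ∩ circle (I * R₁) R₁) \ circle (-I * R₂) R₂) := by
  have hs2 : 0 < s ^ 2 := by positivity
  have hD : R₁ ^ 2 + s ^ 2 ≠ 0 := by positivity
  have hp : 0 < 4 * s ^ 2 * R₁ * (R₁ + R₂) / (R₁ ^ 2 + s ^ 2) := by positivity
  refine ⟨⟨⟨-2 * s * R₁ ^ 2 / (R₁ ^ 2 + s ^ 2), -2 * s ^ 2 * R₁ / (R₁ ^ 2 + s ^ 2)⟩, ⟨?_, ?_⟩, ?_⟩,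
    ⟨⟨-2 * s * R₁ ^ 2 / (R₁ ^ 2 + s ^ 2), 2 * s ^ 2 * R₁ / (R₁ ^ 2 + s ^ 2)⟩, ⟨?_, ?_⟩, ?_⟩⟩
  all_goals rw [mem_circle_iff]; simp
  · field_simp; ring
  · field_simp; ring
  · intro h
    apply hp.ne'
    have h' := sub_eq_zero.2 h
    rw [← h']
    field_simp; ring
  · field_simp; ring
  · field_simp; ring
  · intro h
    apply hp.ne'
    have h' := sub_eq_zero.2 h
    rw [← h']
    field_simp; ring

/-- The orientation condition determines on which side of the circles through `t` the corner
lies. -/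
theorem not_tripleOriented_of_frame {u : ℂ} (hu : ‖u‖ = 1) {s R₁ R₂ : ℝ} (t : ℂ) (hs : s ≠ 0)
    (h₁ : 0 < R₁) (h₂ : 0 < R₂) :
    ¬ TripleOriented (circle (t - s * u) s) (circle (t - I * R₁ * u) R₁)
      (circle (t + I * R₂ * u) R₂) t (-s) := by
  intro H
  obtain ⟨z, hz⟩ := (exists_mem_diff_zero hs h₁ h₂).1
  obtain ⟨w, hw⟩ := (exists_mem_diff_zero hs h₂ h₁).2
  have H' := tripleOriented_of_frame hu (s := s) t h₁ h₂ one_pos (t + u * z) ?_ (t + u * w) ?_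
  · have H := H (t + u * z) ?_ (t + u * w) ?_
    · rcases hs.lt_or_gt with h | h
      · have h1 := H.1 (by linarith); have h2 := H'.2 (by linarith); linarith
      · have h1 := H.2 (by linarith); have h2 := H'.1 (by linarith); linarith
    all_goals
      rw [show t - s * u = t + u * (-s) by ring, show t - I * R₁ * u = t + u * (-I * R₁) by ring,
        show t + I * R₂ * u = t + u * (I * R₂) by ring]
      simp only [Set.mem_sdiff, Set.mem_inter_iff, add_mul_mem_circle_iff hu]
      assumption
  all_goals
    rw [show t - s * u = t + u * (-s) by ring, show t - I * R₁ * u = t + u * (-I * R₁) by ring,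
      show t + I * R₂ * u = t + u * (I * R₂) by ring]
    simp only [Set.mem_sdiff, Set.mem_inter_iff, add_mul_mem_circle_iff hu]
    assumption

theorem OrthogonalCircles.norm_sub_sq {p₁ p₂ : ℂ} {r₁ r₂ : ℝ} (h : OrthogonalCircles p₁ r₁ p₂ r₂) :
    ‖p₁ - p₂‖ ^ 2 = r₁ ^ 2 + r₂ ^ 2 := by
  obtain ⟨q, ⟨h₁, h₂⟩, h⟩ := h
  rw [circle, mem_sphere_iff_norm] at h₁ h₂
  rw [show p₁ - p₂ = (q - p₂) - (q - p₁) by ring, norm_sub_sq_real, real_inner_comm, h, h₁, h₂]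
  simp; ring

theorem OrthogonalCircles.symm {p₁ p₂ : ℂ} {r₁ r₂ : ℝ} (h : OrthogonalCircles p₁ r₁ p₂ r₂) :
    OrthogonalCircles p₂ r₂ p₁ r₁ := by
  obtain ⟨q, hq, h⟩ := h
  exact ⟨q, hq.symm, by rwa [real_inner_comm]⟩

/-- At a common point of orthogonal circles the radii are perpendicular. -/
theorem OrthogonalCircles.inner_eq_zero {p₁ p₂ t : ℂ} {r₁ r₂ : ℝ}
    (h : OrthogonalCircles p₁ r₁ p₂ r₂) (h₁ : t ∈ circle p₁ r₁) (h₂ : t ∈ circle p₂ r₂) :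
    inner ℝ (t - p₁) (t - p₂) = 0 := by
  have h := h.norm_sub_sq
  rw [circle, mem_sphere_iff_norm] at h₁ h₂
  rw [show p₁ - p₂ = (t - p₂) - (t - p₁) by ring, norm_sub_sq_real, real_inner_comm, h₁, h₂,
    sq_abs, sq_abs] at h
  linarith

/-- A corner orthogonal to a circle centred at `t - i R u` lies on the line through `t` with
direction `u`. -/
theorem exists_eq_of_inner_eq_zero {u p t : ℂ} {R r : ℝ} (hu : ‖u‖ = 1) (hR : 0 < R)
    (hp : t ∈ circle p r) (h : inner ℝ (t - p) (I * R * u) = 0) :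
    p = t - r * u ∨ p = t - (-r : ℝ) * u := by
  obtain ⟨z, rfl⟩ := exists_eq_add_mul hu t p
  have hn : Complex.normSq u = 1 := by rw [Complex.normSq_eq_norm_sq, hu]; simp
  rw [Complex.normSq_apply] at hn
  have hz : z.im = 0 := by
    simp [Complex.inner] at h
    have : R * z.im = 0 := by linear_combination -h - R * z.im * hn
    exact (mul_eq_zero.1 this).resolve_left hR.ne'
  have hz' : z = (z.re : ℂ) := by apply Complex.ext <;> simp [hz]
  rw [circle, mem_sphere_iff_norm, hz'] at hp
  simp [hu] at hp
  rcases (abs_eq_abs.1 hp) with h | h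
  · right; rw [hz', h]; push_cast; ring
  · left; rw [hz', h]; push_cast; ring

/-- The corner of a square is determined by the orientation condition. -/
theorem eq_of_tripleOriented {u p t : ℂ} {R₁ R₂ r : ℝ} (hu : ‖u‖ = 1) (h₁ : 0 < R₁) (h₂ : 0 < R₂)
    (hp : t ∈ circle p r) (h : inner ℝ (t - p) (I * R₁ * u) = 0)
    (H : TripleOriented (circle p r) (circle (t - I * R₁ * u) R₁)
      (circle (t + I * R₂ * u) R₂) t r) : p = t - r * u := by
  rcases exists_eq_of_inner_eq_zero hu h₁ hp h with h | h
  · exact h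
  · by_cases hr : r = 0
    · simpa [hr] using h
    · rw [h, ← circle_neg] at H
      have := not_tripleOriented_of_frame hu t (neg_ne_zero.2 hr) h₁ h₂
      rw [neg_neg] at this
      exact absurd H this

/-! ### Ring patterns and circle patterns as frames -/

/-- The centres `c` and touching points `t` of a pattern with (inner and outer) radii `r`, `R`:
in each square the centres lie on the two perpendicular lines through the touching point, whose
directions are `u` and `i u`. -/
structure IsFrame (c t u : ℤ → ℤ → ℂ) (r R : ℤ → ℤ → ℝ) : Prop where
  lower_left : ∀ m n, c m n = t m n - r m n * u m n
  lower_right : ∀ m n, c (m + 1) n = t m n - I * R (m + 1) n * u m n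
  upper_right : ∀ m n, c (m + 1) (n + 1) = t m n + r (m + 1) (n + 1) * u m n
  upper_left : ∀ m n, c m (n + 1) = t m n + I * R m (n + 1) * u m n

theorem mem_circle_sub {u : ℂ} (hu : ‖u‖ = 1) (t : ℂ) (r : ℝ) : t ∈ circle (t - r * u) r := by
  simp [circle, hu]

theorem orthogonalCircles_of_frame {u t p₁ p₂ : ℂ} {r R : ℝ} (hu : ‖u‖ = 1)
    (h₁ : p₁ = t - r * u) (h₂ : p₂ = t - R * (I * u)) : OrthogonalCircles p₁ r p₂ R := by
  refine ⟨t, ⟨?_, ?_⟩, ?_⟩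
  · rw [h₁]; exact mem_circle_sub hu _ _
  · rw [h₂]; exact mem_circle_sub (by simp [hu]) _ _
  · rw [h₁, h₂]; simp [Complex.inner]; ring

namespace RingSystem

/-- The direction is read off from the outer circles, whose radii never vanish, while an inner
radius may be `0`. Touching places the second outer corner, orthogonality puts the inner corners on
the perpendicular line, and the orientation condition selects the side. -/
theorem IsOrthogonalRingPattern.exists_frame {P : RingSystem} (hP : P.IsOrthogonalRingPattern) :
    ∃ u : ℤ → ℤ → ℂ, (∀ m n, ‖u m n‖ = 1) ∧ IsFrame P.center P.touch u P.inner P.outer := by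
  have hR : ∀ m n, 0 < P.outer m n := fun m n => (abs_nonneg _).trans_lt (hP.ring m n)
  have hRc : ∀ m n, (P.outer m n : ℂ) ≠ 0 := fun m n => by exact_mod_cast (hR m n).ne'
  let u : ℤ → ℤ → ℂ := fun m n =>
    (P.touch m n - P.center (m + 1) n) / (I * P.outer (m + 1) n)
  have hB : ∀ m n, P.center (m + 1) n = P.touch m n - I * P.outer (m + 1) n * u m n := by
    intro m n
    have := hRc (m + 1) n
    have hI := Complex.I_ne_zero
    simp only [u]
    field_simp; ring
  have hD : ∀ m n, P.center m (n + 1) = P.touch m n + I * P.outer m (n + 1) * u m n := by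
    intro m n
    have h := (hP.touch_outer m n).2
    rw [hB] at h
    apply mul_left_cancel₀ (hRc (m + 1) n)
    linear_combination -h
  have hu : ∀ m n, ‖u m n‖ = 1 := by
    intro m n
    have h := (hP.touch_outer m n).1.1
    rw [circle, mem_sphere_iff_norm, abs_of_pos (hR _ _)] at h
    simp only [u]
    rw [norm_div, h]
    simp [abs_of_pos (hR (m + 1) n), (hR (m + 1) n).ne']
  refine ⟨u, hu, fun m n => ?_, hB, fun m n => ?_, hD⟩
  · have h := (hP.orthogonal_horizontal m n).2.inner_eq_zero (hP.touch_inner m n).1.1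
      (hP.touch_outer m n).1.1
    rw [show P.touch m n - P.center (m + 1) n = I * P.outer (m + 1) n * u m n by
      rw [hB]; ring] at h
    have H := hP.orient_lower_left m n
    simp only [innerCircle, outerCircle, hB, hD] at H
    exact eq_of_tripleOriented (hu m n) (hR _ _) (hR _ _) (hP.touch_inner m n).1.1 h H
  · have h := (hP.orthogonal_horizontal m (n + 1)).1.symm.inner_eq_zero (hP.touch_inner m n).1.2
      (hP.touch_outer m n).1.2
    rw [show P.touch m n - P.center m (n + 1) = I * P.outer m (n + 1) * -u m n by
      rw [hD]; ring] at h
    have H := hP.orient_upper_right m n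
    unfold innerCircle outerCircle at H
    rw [hB m n, hD m n] at H
    -- A half-turn about the touching point exchanges the two inner corners, and with them the two
    -- outer ones.
    have := eq_of_tripleOriented (u := -u m n) (by simpa using hu m n) (hR m (n + 1))
      (hR (m + 1) n) (hP.touch_inner m n).1.2 h (by convert H using 2 <;> ring)
    rw [this]; ring

end RingSystem

theorem IsFrame.isOrthogonalRingPattern {P : RingSystem} {u : ℤ → ℤ → ℂ}
    (h : IsFrame P.center P.touch u P.inner P.outer) (hu : ∀ m n, ‖u m n‖ = 1)
    (hr : ∀ m n, |P.inner m n| < P.outer m n) : P.IsOrthogonalRingPattern := by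
  have hR : ∀ m n, 0 < P.outer m n := fun m n => (abs_nonneg _).trans_lt (hr m n)
  obtain ⟨hA, hB, hC, hD⟩ := h
  refine ⟨hr, fun m n => ⟨?_, ?_⟩, fun m n => ⟨?_, ?_⟩, fun m n => ⟨⟨?_, ?_⟩, ?_⟩,
    fun m n => ⟨⟨?_, ?_⟩, ?_⟩, fun m n => ?_, fun m n => ?_, fun m n h1 h2 => ?_,
    fun m n h1 h2 => ?_, fun m n h1 h2 => ?_, fun m n h1 h2 => ?_⟩
  -- In the square above the edge, `(m, n)` carries the inner circle and `(m + 1, n)` the outer one.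
  -- The opposite pairing comes from the square below, and for vertical edges from the square to the
  -- left.
  · obtain ⟨k, rfl⟩ : ∃ k, n = k + 1 := ⟨n - 1, by ring⟩
    exact (orthogonalCircles_of_frame (u := -u m k) (by simpa using hu m k)
      (by rw [hC m k]; ring) (by rw [hD m k]; ring)).symm
  · exact orthogonalCircles_of_frame (hu m n) (hA m n) (by rw [hB m n]; ring)
  · obtain ⟨k, rfl⟩ : ∃ k, m = k + 1 := ⟨m - 1, by ring⟩
    refine OrthogonalCircles.symm ?_
    have := hu k n
    refine ⟨P.touch k n, ⟨?_, ?_⟩, ?_⟩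
    · rw [hC]; simp [circle, this]
    · rw [hB]; simp [circle, this]
    · rw [hC, hB]; simp [Complex.inner]; ring
  · have := hu m n
    refine ⟨P.touch m n, ⟨?_, ?_⟩, ?_⟩
    · rw [hA]; simp [circle, this]
    · rw [hD]; simp [circle, this]
    · rw [hA, hD]; simp [Complex.inner]; ring
  · rw [hA]; simp [circle, hu m n]
  · rw [hC]; simp [circle, hu m n]
  · rw [hA m n, hC]; ring
  · rw [hB]; simp [circle, hu m n]
  · rw [hD]; simp [circle, hu m n]
  · rw [hB, hD]; ring
  · have := tripleOriented_of_frame (hu m n) (s := P.inner m n) (P.touch m n) (hR (m + 1) n)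
      (hR m (n + 1)) one_pos
    rw [← hA, ← hB, ← hD, one_mul] at this
    exact this
  · have := tripleOriented_of_frame (u := -u m n) (by simpa using hu m n)
      (s := P.inner (m + 1) (n + 1)) (P.touch m n) (hR m (n + 1)) (hR (m + 1) n) one_pos
    simp only [mul_neg, sub_neg_eq_add, ← sub_eq_add_neg] at this
    rw [← hC, ← hB, ← hD, one_mul] at this
    exact this
  -- A quarter-turn of the frame exchanges the roles of inner and outer circles; the factor `k = 1 /
  -- R` reduces the sign parameter `k s` to `1`.
  · have := tripleOriented_of_frame (u := I * u m n) (by simpa using hu m n)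
      (s := P.outer (m + 1) n) (P.touch m n) h1 h2 (inv_pos.2 (hR (m + 1) n))
    rw [inv_mul_cancel₀ (hR _ _).ne'] at this
    unfold RingSystem.innerCircle RingSystem.outerCircle
    rw [hB, hC, hA]
    convert this using 2
    · ring
    · linear_combination (P.inner (m + 1) (n + 1) * u m n) * Complex.I_sq
    · linear_combination (-P.inner m n * u m n) * Complex.I_sq
  -- For negative inner radii, the frame is turned the other way and all radii change sign: the
  -- neighbours get positive radii, the corner gets `s = -R`, and the circles stay the same as sets.
  · have := tripleOriented_of_frame (u := -I * u m n) (by simpa using hu m n)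
      (s := -P.outer (m + 1) n) (P.touch m n) (neg_pos.2 h1) (neg_pos.2 h2)
      (inv_pos.2 (hR (m + 1) n))
    rw [mul_neg, inv_mul_cancel₀ (hR _ _).ne'] at this
    simp only [circle_neg] at this
    unfold RingSystem.innerCircle RingSystem.outerCircle
    rw [hB, hC, hA]
    convert this using 2
    · push_cast; ring
    · push_cast
      linear_combination (P.inner (m + 1) (n + 1) * u m n) * Complex.I_sq
    · push_cast
      linear_combination (-P.inner m n * u m n) * Complex.I_sq
  · have := tripleOriented_of_frame (u := -I * u m n) (by simpa using hu m n)
      (s := P.outer m (n + 1)) (P.touch m n) h1 h2 (inv_pos.2 (hR m (n + 1)))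
    rw [inv_mul_cancel₀ (hR _ _).ne'] at this
    unfold RingSystem.innerCircle RingSystem.outerCircle
    rw [hD, hC, hA]
    convert this using 2
    · ring
    · linear_combination (-P.inner m n * u m n) * Complex.I_sq
    · linear_combination (P.inner (m + 1) (n + 1) * u m n) * Complex.I_sq
  · have := tripleOriented_of_frame (u := I * u m n) (by simpa using hu m n)
      (s := -P.outer m (n + 1)) (P.touch m n) (neg_pos.2 h1) (neg_pos.2 h2)
      (inv_pos.2 (hR m (n + 1)))
    rw [mul_neg, inv_mul_cancel₀ (hR _ _).ne'] at this
    simp only [circle_neg] at this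
    unfold RingSystem.innerCircle RingSystem.outerCircle
    rw [hD, hC, hA]
    convert this using 2
    · push_cast; ring
    · push_cast
      linear_combination (-P.inner m n * u m n) * Complex.I_sq
    · push_cast
      linear_combination (P.inner (m + 1) (n + 1) * u m n) * Complex.I_sq

/-- Circles touching from different sides have one common point. -/
theorem circle_inter_circle {u : ℂ} (hu : ‖u‖ = 1) (t : ℂ) {r₁ r₂ : ℝ} (h₁ : 0 < r₁)
    (h₂ : 0 < r₂) : circle (t - r₁ * u) r₁ ∩ circle (t + r₂ * u) r₂ = {t} := by
  ext a
  constructor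
  · rintro ⟨ha, hb⟩
    obtain ⟨z, rfl⟩ := exists_eq_add_mul hu t a
    rw [show t - r₁ * u = t + u * (-r₁) by ring, add_mul_mem_circle_iff hu, mem_circle_iff] at ha
    rw [show t + r₂ * u = t + u * r₂ by ring, add_mul_mem_circle_iff hu, mem_circle_iff] at hb
    simp at ha hb
    -- The weights `r₂`, `r₁` cancel the terms linear in `z.re`.
    have h : (r₁ + r₂) * (z.re ^ 2 + z.im ^ 2) = 0 := by linear_combination r₂ * ha + r₁ * hb
    have h := (mul_eq_zero.1 h).resolve_left (by positivity)
    have h1 : z.re = 0 := by nlinarith [sq_nonneg z.re, sq_nonneg z.im]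
    have h2 : z.im = 0 := by nlinarith [sq_nonneg z.re, sq_nonneg z.im]
    have : z = 0 := Complex.ext h1 h2
    simp [this]
  · rintro rfl
    simp [circle, hu]

theorem IsFrame.isOrthogonalCirclePattern {C : CircleSystem} {u : ℤ → ℤ → ℂ}
    (h : IsFrame C.center C.touch u C.radius C.radius) (hu : ∀ m n, ‖u m n‖ = 1)
    (hR : ∀ m n, 0 < C.radius m n) : C.IsOrthogonalCirclePattern := by
  obtain ⟨hA, hB, hC, hD⟩ := h
  refine ⟨hR, fun m n => ?_, fun m n => ?_, fun m n => ?_,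
    fun m n => ?_, fun m n => ?_, fun m n => ?_, fun m n => ?_, fun m n => ?_⟩
  · exact orthogonalCircles_of_frame (hu m n) (hA m n) (by rw [hB m n]; ring)
  · have := hu m n
    refine ⟨C.touch m n, ⟨?_, ?_⟩, ?_⟩
    · rw [hA]; simp [circle, this]
    · rw [hD]; simp [circle, this]
    · rw [hA, hD]; simp [Complex.inner]; ring
  · have := circle_inter_circle (hu m n) (C.touch m n) (hR m n) (hR (m + 1) (n + 1))
    rwa [← hA, ← hC] at this
  · have := circle_inter_circle (u := I * u m n) (by simpa using hu m n) (C.touch m n)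
      (hR (m + 1) n) (hR m (n + 1))
    unfold CircleSystem.circleAt
    rw [hB, hD, ← this]
    congr 2 <;> ring
  · have := tripleOriented_of_frame (hu m n) (s := C.radius m n) (C.touch m n) (hR (m + 1) n)
      (hR m (n + 1)) (inv_pos.2 (hR m n))
    rw [← hA, ← hB, ← hD, inv_mul_cancel₀ (hR _ _).ne'] at this
    exact this
  · have := tripleOriented_of_frame (u := I * u m n) (by simpa using hu m n)
      (s := C.radius (m + 1) n) (C.touch m n) (hR (m + 1) (n + 1)) (hR m n)
      (inv_pos.2 (hR (m + 1) n))
    rw [inv_mul_cancel₀ (hR _ _).ne'] at this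
    unfold CircleSystem.circleAt
    rw [hB, hC, hA]
    convert this using 2
    · ring
    · linear_combination (C.radius (m + 1) (n + 1) * u m n) * Complex.I_sq
    · linear_combination (-C.radius m n * u m n) * Complex.I_sq
  · have := tripleOriented_of_frame (u := -u m n) (by simpa using hu m n)
      (s := C.radius (m + 1) (n + 1)) (C.touch m n) (hR m (n + 1)) (hR (m + 1) n)
      (inv_pos.2 (hR (m + 1) (n + 1)))
    simp only [mul_neg, sub_neg_eq_add, ← sub_eq_add_neg] at this
    rw [← hC, ← hB, ← hD, inv_mul_cancel₀ (hR _ _).ne'] at this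
    exact this
  · have := tripleOriented_of_frame (u := -I * u m n) (by simpa using hu m n)
      (s := C.radius m (n + 1)) (C.touch m n) (hR m n) (hR (m + 1) (n + 1))
      (inv_pos.2 (hR m (n + 1)))
    rw [inv_mul_cancel₀ (hR _ _).ne'] at this
    unfold CircleSystem.circleAt
    rw [hD, hC, hA]
    convert this using 2
    · ring
    · linear_combination (-C.radius m n * u m n) * Complex.I_sq
    · linear_combination (C.radius (m + 1) (n + 1) * u m n) * Complex.I_sq

/-! ### Linear structure and rigidity of frames -/

theorem eq_zero_zero_of_step {f : ℤ → ℤ → ℂ} (h₁ : ∀ m n, f (m + 1) n = f m n)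
    (h₂ : ∀ m n, f m (n + 1) = f m n) (m n : ℤ) : f m n = f 0 0 := by
  have hm : ∀ m, f m 0 = f 0 0 := fun m => by
    induction m using Int.induction_on with
    | zero => rfl
    | succ i ih => rw [h₁, ih]
    | pred i ih => rw [← h₁, sub_add_cancel, ih]
  induction n using Int.induction_on with
  | zero => exact hm m
  | succ i ih => rw [h₂, ih]
  | pred i ih => rw [← h₂, sub_add_cancel, ih]

theorem ofReal_sub_I_mul_ne_zero {a b : ℝ} (hb : b ≠ 0) : (a : ℂ) - I * b ≠ 0 := by
  intro h
  have := congrArg Complex.im h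
  simp at this
  exact hb this

theorem ofReal_add_I_mul_ne_zero {a b : ℝ} (hb : b ≠ 0) : (a : ℂ) + I * b ≠ 0 := by
  intro h
  have := congrArg Complex.im h
  simp at this
  exact hb this

namespace IsFrame

variable {c t u c' t' u' : ℤ → ℤ → ℂ} {r R r' R' : ℤ → ℤ → ℝ}

theorem move (h : IsFrame c t u r R) (a b : ℂ) :
    IsFrame (fun m n => a * c m n + b) (fun m n => a * t m n + b) (fun m n => a * u m n) r R where
  lower_left m n := by rw [h.lower_left]; ring
  lower_right m n := by rw [h.lower_right]; ring
  upper_right m n := by rw [h.upper_right]; ring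
  upper_left m n := by rw [h.upper_left]; ring

/-- Superposition principle: for fixed directions the frame equations are linear in centres,
touching points and radii. -/
theorem sub (h : IsFrame c t u r R) (h' : IsFrame c' t' u r' R') (k k' : ℝ) :
    IsFrame (fun m n => k * c m n - k' * c' m n) (fun m n => k * t m n - k' * t' m n) u
      (fun m n => k * r m n - k' * r' m n) (fun m n => k * R m n - k' * R' m n) where
  lower_left m n := by rw [h.lower_left, h'.lower_left]; push_cast; ring
  lower_right m n := by rw [h.lower_right, h'.lower_right]; push_cast; ring
  upper_right m n := by rw [h.upper_right, h'.upper_right]; push_cast; ring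
  upper_left m n := by rw [h.upper_left, h'.upper_left]; push_cast; ring

/-- Reflection changes the sign of `i`, which is absorbed in the outer radii. This sign later
separates `sinh` from `cosh`. -/
theorem conj (h : IsFrame c t u r R) :
    IsFrame (fun m n => (starRingEnd ℂ) (c m n)) (fun m n => (starRingEnd ℂ) (t m n))
      (fun m n => (starRingEnd ℂ) (u m n)) r (fun m n => - R m n) where
  lower_left m n := by rw [h.lower_left]; simp
  lower_right m n := by rw [h.lower_right]; simp
  upper_right m n := by rw [h.upper_right]; simp
  upper_left m n := by rw [h.upper_left]; simp

theorem horizontal (h : IsFrame c t u r R) (m n : ℤ) :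
    c (m + 1) n - c m n = (r m n - I * R (m + 1) n) * u m n := by
  rw [h.lower_right, h.lower_left m n]; ring

theorem vertical (h : IsFrame c t u r R) (m n : ℤ) :
    c m (n + 1) - c m n = (r m n + I * R m (n + 1)) * u m n := by
  rw [h.upper_left, h.lower_left m n]; ring

/-- The edge from `(m, n + 1)` to `(m + 1, n + 1)` belongs to two squares; equating its two
expressions gives a recurrence for `u` whose coefficients depend only on the radii. -/
theorem direction_vertical (h : IsFrame c t u r R) (m n : ℤ) :
    (r m (n + 1) - I * R (m + 1) (n + 1)) * u m (n + 1) =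
      (r (m + 1) (n + 1) - I * R m (n + 1)) * u m n := by
  rw [← h.horizontal, h.upper_right, h.upper_left m n]; ring

theorem direction_horizontal (h : IsFrame c t u r R) (m n : ℤ) :
    (r (m + 1) n + I * R (m + 1) (n + 1)) * u (m + 1) n =
      (r (m + 1) (n + 1) + I * R (m + 1) n) * u m n := by
  rw [← h.vertical, h.upper_right, h.lower_right m n]; ring

/-- The radii determine a frame up to a motion. -/
theorem eq_move (h : IsFrame c t u r R) (h' : IsFrame c' t' u' r R) (hu : ∀ m n, u m n ≠ 0)
    (hR : ∀ m n, R m n ≠ 0) (m n : ℤ) :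
    u' m n = u' 0 0 / u 0 0 * u m n ∧
    c' m n = u' 0 0 / u 0 0 * c m n + (c' 0 0 - u' 0 0 / u 0 0 * c 0 0) ∧
    t' m n = u' 0 0 / u 0 0 * t m n + (c' 0 0 - u' 0 0 / u 0 0 * c 0 0) := by
  set a := u' 0 0 / u 0 0
  -- Both direction fields satisfy the same recurrences, with leading coefficient nonzero because `R
  -- ≠ 0`, so their quotient is constant.
  have hk : ∀ m n, u' m n / u m n = a := by
    refine eq_zero_zero_of_step (f := fun m n => u' m n / u m n) (fun m n => ?_) (fun m n => ?_)
    · rw [div_eq_div_iff (hu _ _) (hu _ _)]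
      apply mul_left_cancel₀ (ofReal_add_I_mul_ne_zero (a := r (m + 1) n) (hR (m + 1) (n + 1)))
      linear_combination u m n * h'.direction_horizontal m n - u' m n * h.direction_horizontal m n
    · rw [div_eq_div_iff (hu _ _) (hu _ _)]
      apply mul_left_cancel₀ (ofReal_sub_I_mul_ne_zero (a := r m (n + 1)) (hR (m + 1) (n + 1)))
      linear_combination u m n * h'.direction_vertical m n - u' m n * h.direction_vertical m n
  have hu' : ∀ m n, u' m n = a * u m n := fun m n => by
    rw [← hk m n, div_mul_cancel₀ _ (hu m n)]
  have hc : c' m n = a * c m n + (c' 0 0 - a * c 0 0) := by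
    have := eq_zero_zero_of_step (f := fun m n => c' m n - a * c m n) (fun m n => ?_)
      (fun m n => ?_) m n
    · linear_combination this
    · have h1 := h.horizontal m n
      have h2 := h'.horizontal m n
      rw [hu'] at h2
      linear_combination h2 - a * h1
    · have h1 := h.vertical m n
      have h2 := h'.vertical m n
      rw [hu'] at h2
      linear_combination h2 - a * h1
  refine ⟨hu' m n, hc, ?_⟩
  have h1 := h.lower_left m n
  have h2 := h'.lower_left m n
  rw [hu'] at h2
  linear_combination hc - h2 + a * h1

end IsFrame

/-! ### The turning factor of a Doyle spiral -/

/-- The unit complex number `(1 + i e^s) / (e^s + i)` by which the frame of a Doyle spiral turns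
along edges with quotient of radii `e^s`. -/
noncomputable def doyleRatio (s : ℝ) : ℂ := (1 + Real.exp s * I) / (Real.exp s + I)

theorem ofReal_add_I_ne_zero (a : ℝ) : (a : ℂ) + I ≠ 0 := by
  simpa using ofReal_add_I_mul_ne_zero (a := a) one_ne_zero

theorem norm_doyleRatio (s : ℝ) : ‖doyleRatio s‖ = 1 := by
  have h : ‖(1 : ℂ) + Real.exp s * I‖ = ‖(Real.exp s : ℂ) + I‖ := by
    rw [← sq_eq_sq₀ (norm_nonneg _) (norm_nonneg _), ← Complex.normSq_eq_norm_sq,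
      ← Complex.normSq_eq_norm_sq, Complex.normSq_apply, Complex.normSq_apply]
    simp only [Complex.add_re, Complex.add_im, Complex.mul_re, Complex.mul_im, Complex.ofReal_re,
      Complex.ofReal_im, Complex.I_re, Complex.I_im, Complex.one_re, Complex.one_im]
    ring
  rw [doyleRatio, norm_div, h, div_self (norm_ne_zero_iff.2 (ofReal_add_I_ne_zero _))]

theorem doyleRatio_ne_zero (s : ℝ) : doyleRatio s ≠ 0 := by
  rw [← norm_ne_zero_iff, norm_doyleRatio]; exact one_ne_zero

theorem doyleRatio_mul (s : ℝ) : doyleRatio s * (Real.exp s + I) = 1 + Real.exp s * I :=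
  div_mul_cancel₀ _ (ofReal_add_I_ne_zero _)

theorem doyleRatio_neg_mul (s : ℝ) : doyleRatio (-s) * doyleRatio s = 1 := by
  have h1 := doyleRatio_mul s
  have h2 := doyleRatio_mul (-s)
  have he : (Real.exp (-s) : ℂ) * Real.exp s = 1 := by
    rw [← Complex.ofReal_mul, ← Real.exp_add]; simp
  have h3 : doyleRatio (-s) * (1 + Real.exp s * I) = Real.exp s + I := by
    linear_combination (Real.exp s : ℂ) * h2 + (I - doyleRatio (-s)) * he
  apply mul_right_cancel₀ (ofReal_add_I_ne_zero (Real.exp s))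
  linear_combination doyleRatio (-s) * h1 + h3

theorem doyleRatio_neg (s : ℝ) : doyleRatio (-s) = (doyleRatio s)⁻¹ :=
  eq_inv_of_mul_eq_one_left (doyleRatio_neg_mul s)

theorem conj_doyleRatio (s : ℝ) : (starRingEnd ℂ) (doyleRatio s) = doyleRatio (-s) := by
  rw [doyleRatio_neg, Complex.inv_eq_conj (norm_doyleRatio s)]

/-- With `w = e^s + i`, of argument `θ = arctan (e^(-s))`, the turning factor is `i w̄ / w = i
e^(-2iθ)`. -/
theorem I_mul_doyleRatio (s : ℝ) : I * doyleRatio s =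
    -(Complex.cos (2 * Real.arctan (Real.exp (-s)) : ℝ) -
      Complex.sin (2 * Real.arctan (Real.exp (-s)) : ℝ) * I) := by
  set θ := Real.arctan (Real.exp (-s)) with hθ
  have hc := Real.cos_arctan_pos (Real.exp (-s))
  have hs : Real.cos θ = Real.exp s * Real.sin θ := by
    have := Real.tan_arctan (Real.exp (-s))
    rw [Real.tan_eq_sin_div_cos, ← hθ, div_eq_iff hc.ne'] at this
    rw [this, ← mul_assoc, ← Real.exp_add]; simp [hθ]
  have h1 : (Real.sin θ : ℂ) ^ 2 * (Real.exp s ^ 2 + 1) = 1 := by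
    have := Real.sin_sq_add_cos_sq θ
    rw [hs] at this
    exact_mod_cast (by linear_combination this :
      Real.sin θ ^ 2 * (Real.exp s ^ 2 + 1) = 1)
  rw [← Complex.ofReal_cos, ← Complex.ofReal_sin, Real.cos_two_mul', Real.sin_two_mul, hs]
  apply mul_right_cancel₀ (ofReal_add_I_ne_zero (Real.exp s))
  simp only [Complex.ofReal_mul, Complex.ofReal_sub, Complex.ofReal_pow, Complex.ofReal_ofNat]
  rw [mul_assoc, doyleRatio_mul]
  linear_combination (Real.exp s - I) * h1 +
    (Real.exp s - 2 * Real.sin θ ^ 2 * Real.exp s) * Complex.I_sq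

/-- Since `0 < θ < π / 2`, both `π - 2θ` (here) and `-2θ` (for negative `k`) lie in the principal
branch. -/
theorem arg_mul_I_mul_doyleRatio_of_pos {k : ℝ} (hk : 0 < k) (s : ℝ) :
    Complex.arg (k * (I * doyleRatio s)) = Real.pi - 2 * Real.arctan (Real.exp (-s)) := by
  have h1 := Real.arctan_lt_pi_div_two (Real.exp (-s))
  have h2 := Real.arctan_pos.2 (Real.exp_pos (-s))
  rw [I_mul_doyleRatio, Complex.arg_real_mul _ hk]
  rw [← Complex.arg_cos_add_sin_mul_I (θ := Real.pi - 2 * Real.arctan (Real.exp (-s)))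
    ⟨by linarith, by linarith⟩]
  congr 1
  rw [← Complex.ofReal_cos, ← Complex.ofReal_sin, ← Complex.ofReal_cos, ← Complex.ofReal_sin,
    Real.cos_pi_sub, Real.sin_pi_sub]
  push_cast; ring

theorem arg_mul_I_mul_doyleRatio_of_neg {k : ℝ} (hk : k < 0) (s : ℝ) :
    Complex.arg (k * (I * doyleRatio s)) = -2 * Real.arctan (Real.exp (-s)) := by
  have h1 := Real.arctan_lt_pi_div_two (Real.exp (-s))
  have h2 := Real.arctan_pos.2 (Real.exp_pos (-s))
  rw [I_mul_doyleRatio, mul_neg, ← neg_mul, ← Complex.ofReal_neg,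
    Complex.arg_real_mul _ (neg_pos.2 hk)]
  rw [← Complex.arg_cos_add_sin_mul_I (θ := -2 * Real.arctan (Real.exp (-s)))
    ⟨by linarith, by linarith [Real.pi_pos]⟩]
  congr 1
  rw [← Complex.ofReal_cos, ← Complex.ofReal_sin, ← Complex.ofReal_cos, ← Complex.ofReal_sin,
    neg_mul, Real.cos_neg, Real.sin_neg]
  push_cast; ring

/-! ### The explicit Doyle spiral -/

/-- The directions of the frame of a Doyle spiral. -/
noncomputable def doyleFrame (x y : ℝ) (m n : ℤ) : ℂ := doyleRatio y ^ m * doyleRatio x ^ n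

theorem norm_doyleFrame (x y : ℝ) (m n : ℤ) : ‖doyleFrame x y m n‖ = 1 := by
  simp [doyleFrame, norm_doyleRatio]

theorem doyleFrame_ne_zero (x y : ℝ) (m n : ℤ) : doyleFrame x y m n ≠ 0 := by
  rw [← norm_ne_zero_iff, norm_doyleFrame]; exact one_ne_zero

theorem doyleFrame_succ_left (x y : ℝ) (m n : ℤ) :
    doyleFrame x y (m + 1) n = doyleRatio y * doyleFrame x y m n := by
  rw [doyleFrame, doyleFrame, zpow_add_one₀ (doyleRatio_ne_zero y)]; ring

theorem doyleFrame_succ_right (x y : ℝ) (m n : ℤ) :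
    doyleFrame x y m (n + 1) = doyleRatio x * doyleFrame x y m n := by
  rw [doyleFrame, doyleFrame, zpow_add_one₀ (doyleRatio_ne_zero x)]; ring

/-- This is what allows the spiral and the mirror image of its dual to be superposed. -/
theorem conj_doyleFrame_neg (x y : ℝ) (m n : ℤ) :
    (starRingEnd ℂ) (doyleFrame (-x) (-y) m n) = doyleFrame x y m n := by
  simp only [doyleFrame, map_mul, map_zpow₀, conj_doyleRatio, neg_neg]

/-- The radii of a Doyle spiral. -/
noncomputable def doyleRadius (x y : ℝ) (m n : ℤ) : ℝ := Real.exp (doyleRho x y m n)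

theorem doyleRadius_pos (x y : ℝ) (m n : ℤ) : 0 < doyleRadius x y m n := Real.exp_pos _

theorem doyleRadius_succ_left (x y : ℝ) (m n : ℤ) :
    doyleRadius x y (m + 1) n = Real.exp x * doyleRadius x y m n := by
  rw [doyleRadius, doyleRadius, ← Real.exp_add]
  congr 1; simp only [doyleRho]; push_cast; ring

theorem doyleRadius_succ_right (x y : ℝ) (m n : ℤ) :
    Real.exp y * doyleRadius x y m (n + 1) = doyleRadius x y m n := by
  rw [doyleRadius, doyleRadius, ← Real.exp_add]
  congr 1; simp only [doyleRho]; push_cast; ring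

theorem doyleRho_neg (x y : ℝ) (m n : ℤ) : doyleRho (-x) (-y) m n = -doyleRho x y m n := by
  simp only [doyleRho]; ring

/-- The centres of a Doyle spiral, a geometric progression in both directions. -/
noncomputable def doyleCenter (x y : ℝ) (m n : ℤ) : ℂ :=
  (1 - Real.exp x * I) / (Real.exp x * doyleRatio y - 1) * doyleRadius x y m n * doyleFrame x y m n

/-- The touching points of a Doyle spiral. -/
noncomputable def doyleTouch (x y : ℝ) (m n : ℤ) : ℂ :=
  doyleCenter x y m n + doyleRadius x y m n * doyleFrame x y m n

/-- Here `x + iy ≠ 0` enters: a horizontal multiplier `1` forces `x = 0` by its norm and then `e^y =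
1`. The centres would then form an arithmetic progression instead of a geometric one. -/
theorem exp_mul_doyleRatio_sub_one_ne_zero {x y : ℝ} (hxy : (x : ℂ) + y * I ≠ 0) :
    Real.exp x * doyleRatio y - 1 ≠ 0 := by
  intro h
  have h := sub_eq_zero.1 h
  have hx : x = 0 := by
    have h1 := congrArg norm h
    rw [norm_mul, norm_doyleRatio] at h1
    simpa using h1
  have hy := doyleRatio_mul y
  rw [hx] at h
  simp only [Real.exp_zero, Complex.ofReal_one, one_mul] at h
  rw [h, one_mul] at hy
  have := congrArg Complex.re hy
  simp [Complex.exp_ofReal_re] at this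
  simp [hx, this] at hxy

theorem isFrame_doyle {x y : ℝ} (hxy : (x : ℂ) + y * I ≠ 0) :
    IsFrame (doyleCenter x y) (doyleTouch x y) (doyleFrame x y) (doyleRadius x y)
      (doyleRadius x y) := by
  have hq := exp_mul_doyleRatio_sub_one_ne_zero hxy
  have hX : (Real.exp x : ℂ) ≠ 0 := by exact_mod_cast (Real.exp_pos x).ne'
  have hY : (Real.exp y : ℂ) ≠ 0 := by exact_mod_cast (Real.exp_pos y).ne'
  have hYI := ofReal_add_I_ne_zero (Real.exp y)
  have hx := doyleRatio_mul x
  have hy := doyleRatio_mul y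
  -- The constant `κ` in `doyleCenter` is the solution of the horizontal edge equation `κ (e^x q_y -
  -- 1) = 1 - i e^x`, where `q_s` is the turning factor.
  have h₁ : ∀ m n, doyleCenter x y (m + 1) n = doyleTouch x y m n -
      I * doyleRadius x y (m + 1) n * doyleFrame x y m n := by
    intro m n
    simp only [doyleTouch, doyleCenter, doyleRadius_succ_left, doyleFrame_succ_left,
      Complex.ofReal_mul]
    field_simp
    ring
  -- Compatibility: the vertical edge equation `κ (q_x - e^y) = e^y + i` has the same solution `κ`.
  have hκ : (1 - Real.exp x * I) * (doyleRatio x - Real.exp y) =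
      (Real.exp y + I) * (Real.exp x * doyleRatio y - 1) := by
    linear_combination (-I) * hx - Real.exp x * hy +
      (doyleRatio x - Real.exp x) * Complex.I_sq
  have h₂ : ∀ m n, doyleCenter x y m (n + 1) = doyleTouch x y m n +
      I * doyleRadius x y m (n + 1) * doyleFrame x y m n := by
    intro m n
    simp only [doyleTouch, doyleCenter, ← doyleRadius_succ_right x y m n, doyleFrame_succ_right,
      Complex.ofReal_mul]
    field_simp
    linear_combination (doyleRadius x y m (n + 1) * doyleFrame x y m n) * hκ
  refine ⟨fun m n => by rw [doyleTouch]; ring, h₁, fun m n => ?_, h₂⟩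
  rw [h₂ (m + 1) n, doyleTouch, h₁, doyleFrame_succ_left, ← doyleRadius_succ_right x y (m + 1) n]
  simp only [Complex.ofReal_mul]
  linear_combination (doyleRadius x y (m + 1) (n + 1) * doyleFrame x y m n) * hy

/-- A Doyle spiral, placed with the centre of the circle at `(0, 0)` at the origin. -/
noncomputable def doyleSpiral (a : ℂ) (x y : ℝ) : CircleSystem where
  center m n := a * (doyleCenter x y m n - doyleCenter x y 0 0)
  radius := doyleRadius x y
  touch m n := a * (doyleTouch x y m n - doyleCenter x y 0 0)

theorem doyleSpiral_isOrthogonalCirclePattern {x y : ℝ} (hxy : (x : ℂ) + y * I ≠ 0) {a : ℂ}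
    (ha : ‖a‖ = 1) : (doyleSpiral a x y).IsOrthogonalCirclePattern := by
  refine IsFrame.isOrthogonalCirclePattern (u := fun m n => a * doyleFrame x y m n) ?_
    (fun m n => by rw [norm_mul, ha, norm_doyleFrame, one_mul]) (doyleRadius_pos x y)
  have := (isFrame_doyle hxy).move a (-a * doyleCenter x y 0 0)
  convert this using 1
  · funext m n; simp only [doyleSpiral]; ring
  · funext m n; simp only [doyleSpiral]; ring
  · rfl
  · rfl

/-! ### The ring pattern as a superposition, and its normalization -/

/-- The Doyle spiral ring pattern: a superposition of a Doyle spiral and the mirror image of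
its dual. -/
noncomputable def doyleRing (x y ℓ δ : ℝ) : RingSystem where
  center m n := (ℓ / 2 * Real.exp δ : ℝ) * doyleCenter x y m n -
    (ℓ / 2 * Real.exp (-δ) : ℝ) * (starRingEnd ℂ) (doyleCenter (-x) (-y) m n)
  inner m n := ℓ * Real.sinh (doyleRho x y m n + δ)
  outer m n := ℓ * Real.cosh (doyleRho x y m n + δ)
  touch m n := (ℓ / 2 * Real.exp δ : ℝ) * doyleTouch x y m n -
    (ℓ / 2 * Real.exp (-δ) : ℝ) * (starRingEnd ℂ) (doyleTouch (-x) (-y) m n)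

theorem neg_ne_zero_of_ne_zero {x y : ℝ} (hxy : (x : ℂ) + y * I ≠ 0) :
    ((-x : ℝ) : ℂ) + (-y : ℝ) * I ≠ 0 := by
  intro h; apply hxy; push_cast at h; linear_combination -h

theorem isFrame_doyleRing {x y : ℝ} (hxy : (x : ℂ) + y * I ≠ 0) (ℓ δ : ℝ) :
    IsFrame (doyleRing x y ℓ δ).center (doyleRing x y ℓ δ).touch (doyleFrame x y)
      (doyleRing x y ℓ δ).inner (doyleRing x y ℓ δ).outer := by
  have h := (isFrame_doyle (neg_ne_zero_of_ne_zero hxy)).conj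
  simp only [conj_doyleFrame_neg] at h
  have := (isFrame_doyle hxy).sub h (ℓ / 2 * Real.exp δ) (ℓ / 2 * Real.exp (-δ))
  convert this using 1
  · rfl
  · rfl
  · funext m n
    simp only [doyleRing, Real.sinh_eq, doyleRadius, doyleRho_neg, neg_add, Real.exp_add]
    ring
  · funext m n
    simp only [doyleRing, Real.cosh_eq, doyleRadius, doyleRho_neg, neg_add, Real.exp_add]
    ring

/-- The unit complex number that rotates `z` to the positive real axis. -/
noncomputable def unitConj (z : ℂ) : ℂ := (starRingEnd ℂ) z / ‖z‖

theorem norm_unitConj {z : ℂ} (hz : z ≠ 0) : ‖unitConj z‖ = 1 := by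
  simp [unitConj, hz]

theorem unitConj_mul_self (z : ℂ) : unitConj z * z = ‖z‖ := by
  rcases eq_or_ne z 0 with rfl | hz
  · simp
  · have : (‖z‖ : ℂ) ≠ 0 := by simpa using hz
    rw [unitConj, div_mul_eq_mul_div, ← Complex.normSq_eq_conj_mul_self,
      Complex.normSq_eq_norm_sq]
    field_simp; push_cast; ring

/-- Hence normalizing commutes with scaling, and limits can be taken before normalization. -/
theorem unitConj_ofReal_mul {s : ℝ} (hs : 0 < s) (z : ℂ) : unitConj (s * z) = unitConj z := by
  have : (s : ℂ) ≠ 0 := by exact_mod_cast hs.ne'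
  simp only [unitConj, map_mul, Complex.conj_ofReal, norm_mul, Complex.norm_real, Real.norm_eq_abs,
    abs_of_pos hs, Complex.ofReal_mul]
  rw [mul_div_mul_left _ _ this]

theorem continuousAt_unitConj {z : ℂ} (hz : z ≠ 0) : ContinuousAt unitConj z := by
  unfold unitConj
  refine ContinuousAt.div (by fun_prop) (by fun_prop) ?_
  simpa using hz

theorem eq_unitConj {a z : ℂ} (ha : ‖a‖ = 1) (hre : 0 < (a * z).re) (him : (a * z).im = 0) :
    a = unitConj z := by
  have hz : z ≠ 0 := by rintro rfl; simp at hre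
  have h : a * z = ‖z‖ := by
    have h1 : a * z = ((a * z).re : ℂ) := by apply Complex.ext <;> simp [him]
    have h2 : ‖a * z‖ = (a * z).re := by
      rw [h1, Complex.norm_real, Real.norm_eq_abs, Complex.ofReal_re, abs_of_pos hre]
    rw [h1, ← h2, norm_mul, ha, one_mul]
  apply mul_right_cancel₀ hz
  rw [h, unitConj_mul_self]

theorem abs_sinh_lt_cosh (t : ℝ) : |Real.sinh t| < Real.cosh t := by
  rw [Real.sinh_eq, Real.cosh_eq, abs_lt]
  have h1 := Real.exp_pos t
  have h2 := Real.exp_pos (-t)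
  constructor <;> linarith

theorem doyleRing_outer_pos (x y : ℝ) {ℓ : ℝ} (hℓ : 0 < ℓ) (δ : ℝ) (m n : ℤ) :
    0 < (doyleRing x y ℓ δ).outer m n := mul_pos hℓ (Real.cosh_pos _)

theorem doyleRing_center_ne {x y : ℝ} (hxy : (x : ℂ) + y * I ≠ 0) {ℓ : ℝ} (hℓ : 0 < ℓ) (δ : ℝ) :
    (doyleRing x y ℓ δ).center 1 0 - (doyleRing x y ℓ δ).center 0 0 ≠ 0 := by
  have h := (isFrame_doyleRing hxy ℓ δ).horizontal 0 0
  rw [zero_add] at h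
  rw [h]
  exact mul_ne_zero (ofReal_sub_I_mul_ne_zero (doyleRing_outer_pos x y hℓ δ 1 0).ne')
    (doyleFrame_ne_zero x y 0 0)

theorem doyleCenter_ne {x y : ℝ} (hxy : (x : ℂ) + y * I ≠ 0) :
    doyleCenter x y 1 0 - doyleCenter x y 0 0 ≠ 0 := by
  have h := (isFrame_doyle hxy).horizontal 0 0
  rw [zero_add] at h
  rw [h]
  exact mul_ne_zero (ofReal_sub_I_mul_ne_zero (doyleRadius_pos x y 1 0).ne')
    (doyleFrame_ne_zero x y 0 0)

namespace RingSystem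

/-- The pattern moved such that the ring at `(0, 0)` is centred at the origin and the one at
`(1, 0)` on the positive real axis. -/
noncomputable def normalize (P : RingSystem) : RingSystem where
  center m n := unitConj (P.center 1 0 - P.center 0 0) * (P.center m n - P.center 0 0)
  inner := P.inner
  outer := P.outer
  touch m n := unitConj (P.center 1 0 - P.center 0 0) * (P.touch m n - P.center 0 0)

theorem exists_doyleRing {x y : ℝ} (hxy : (x : ℂ) + y * I ≠ 0) {ℓ : ℝ} (hℓ : 0 < ℓ) (δ : ℝ) :
    ∃ P : RingSystem, P.IsOrthogonalRingPattern ∧ P.Normalized ∧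
      P.HasRhoRadii ℓ (fun m n => doyleRho x y m n + δ) := by
  have hz := doyleRing_center_ne hxy hℓ δ
  set a := unitConj ((doyleRing x y ℓ δ).center 1 0 - (doyleRing x y ℓ δ).center 0 0) with ha
  refine ⟨(doyleRing x y ℓ δ).normalize, ?_, ⟨?_, ?_, ?_⟩, fun m n => ⟨rfl, rfl⟩⟩
  · refine IsFrame.isOrthogonalRingPattern (u := fun m n => a * doyleFrame x y m n) ?_
      (fun m n => by rw [norm_mul, norm_unitConj hz, norm_doyleFrame, one_mul]) (fun m n => ?_)
    · have := (isFrame_doyleRing hxy ℓ δ).move a (-a * (doyleRing x y ℓ δ).center 0 0)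
      convert this using 1
      · funext m n; simp only [normalize]; ring
      · funext m n; simp only [normalize]; ring
      · rfl
      · rfl
    · change |ℓ * Real.sinh _| < ℓ * Real.cosh _
      rw [abs_mul, abs_of_pos hℓ]
      exact mul_lt_mul_of_pos_left (abs_sinh_lt_cosh _) hℓ
  · simp [normalize]
  · simp only [normalize, unitConj_mul_self, Complex.ofReal_re]
    exact norm_pos_iff.2 hz
  · simp only [normalize, unitConj_mul_self, Complex.ofReal_im]

/-! ### Uniqueness and angles -/

variable {P Q : RingSystem} {ℓ δ x y : ℝ}

theorem IsOrthogonalRingPattern.outer_ne_zero (hP : P.IsOrthogonalRingPattern) (m n : ℤ) :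
    P.outer m n ≠ 0 := ((abs_nonneg _).trans_lt (hP.ring m n)).ne'

theorem HasRhoRadii.inner_eq {ρ : ℤ → ℤ → ℝ} (hP : P.HasRhoRadii ℓ ρ) :
    P.inner = fun m n => ℓ * Real.sinh (ρ m n) := by
  funext m n; exact (hP m n).2

theorem HasRhoRadii.outer_eq {ρ : ℤ → ℤ → ℝ} (hP : P.HasRhoRadii ℓ ρ) :
    P.outer = fun m n => ℓ * Real.cosh (ρ m n) := by
  funext m n; exact (hP m n).1

/-- Ring patterns with equal radii differ by a motion. -/
theorem IsOrthogonalRingPattern.congruent (hP : P.IsOrthogonalRingPattern)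
    (hQ : Q.IsOrthogonalRingPattern) (hi : Q.inner = P.inner) (ho : Q.outer = P.outer) :
    P.Congruent Q := by
  obtain ⟨u, hu, h⟩ := hP.exists_frame
  obtain ⟨u', hu', h'⟩ := hQ.exists_frame
  rw [hi, ho] at h'
  have hne : ∀ m n, u m n ≠ 0 := fun m n h0 => by simpa [h0] using hu m n
  refine ⟨hi, ho, u' 0 0 / u 0 0, Q.center 0 0 - u' 0 0 / u 0 0 * P.center 0 0, ?_,
    fun m n => (h.eq_move h' hne hP.outer_ne_zero m n).2⟩
  rw [norm_div, hu, hu', div_one]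

/-- Comparison of a pattern with Doyle radii with the explicit one. -/
theorem IsOrthogonalRingPattern.eq_move_doyleRing (hxy : (x : ℂ) + y * I ≠ 0)
    (hP : P.IsOrthogonalRingPattern) (hr : P.HasRhoRadii ℓ (fun m n => doyleRho x y m n + δ)) :
    ∃ u : ℤ → ℤ → ℂ, ∃ a : ℂ, IsFrame P.center P.touch u P.inner P.outer ∧ ‖a‖ = 1 ∧
      ∀ m n, u m n = a * doyleFrame x y m n ∧
        P.center m n = a * (doyleRing x y ℓ δ).center m n +
          (P.center 0 0 - a * (doyleRing x y ℓ δ).center 0 0) ∧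
        P.touch m n = a * (doyleRing x y ℓ δ).touch m n +
          (P.center 0 0 - a * (doyleRing x y ℓ δ).center 0 0) := by
  obtain ⟨u, hu, h⟩ := hP.exists_frame
  have h₀ := isFrame_doyleRing hxy ℓ δ
  rw [show (doyleRing x y ℓ δ).inner = P.inner from hr.inner_eq.symm,
    show (doyleRing x y ℓ δ).outer = P.outer from hr.outer_eq.symm] at h₀
  exact ⟨u, u 0 0 / doyleFrame x y 0 0, h,
    by rw [norm_div, hu, norm_doyleFrame, div_one],
    h₀.eq_move h (doyleFrame_ne_zero x y) hP.outer_ne_zero⟩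

theorem IsOrthogonalRingPattern.eq_normalize_doyleRing (hxy : (x : ℂ) + y * I ≠ 0)
    (hP : P.IsOrthogonalRingPattern) (hn : P.Normalized)
    (hr : P.HasRhoRadii ℓ (fun m n => doyleRho x y m n + δ)) :
    P = (doyleRing x y ℓ δ).normalize := by
  obtain ⟨u, a, -, ha, h⟩ := hP.eq_move_doyleRing hxy hr
  obtain ⟨h0, hre, him⟩ := hn
  have h1 := (h 1 0).2.1
  rw [h0, show ∀ z w : ℂ, a * z + (0 - a * w) = a * (z - w) by intros; ring] at h1
  rw [h1] at hre him
  have ha' := eq_unitConj ha hre him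
  ext m n
  · rw [(h m n).2.1, h0, normalize, ← ha']; ring
  · rw [hr.inner_eq]; rfl
  · rw [hr.outer_eq]; rfl
  · rw [(h m n).2.2, h0, normalize, ← ha']; ring

/-- The angles in terms of the quotient of the radii of the ring. -/
theorem IsOrthogonalRingPattern.angles_eq (hxy : (x : ℂ) + y * I ≠ 0)
    (hP : P.IsOrthogonalRingPattern) (hr : P.HasRhoRadii ℓ (fun m n => doyleRho x y m n + δ))
    (m n : ℤ) (h0 : P.inner m n ≠ 0) :
    P.angleEast m n =
      Complex.arg ((P.inner m n / P.outer m n : ℝ) * (I * doyleRatio x)) ∧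
    P.angleWest m n =
      Complex.arg ((P.inner m n / P.outer m n : ℝ) * (I * doyleRatio (-x))) ∧
    P.angleNorth m n =
      Complex.arg ((P.outer m n / P.inner m n : ℝ) * (I * doyleRatio (-y))) ∧
    P.angleSouth m n =
      Complex.arg ((P.outer m n / P.inner m n : ℝ) * (I * doyleRatio y)) := by
  obtain ⟨u, a, h, ha, hu⟩ := hP.eq_move_doyleRing hxy hr
  have ha0 : a ≠ 0 := fun h => by simp [h] at ha
  have hune : ∀ m n, u m n ≠ 0 := fun m n => by
    rw [(hu m n).1]; exact mul_ne_zero ha0 (doyleFrame_ne_zero x y m n)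
  have hl : ∀ m n, u (m + 1) n = doyleRatio y * u m n := fun m n => by
    rw [(hu _ _).1, (hu m n).1, doyleFrame_succ_left]; ring
  have hv : ∀ m n, u m (n + 1) = doyleRatio x * u m n := fun m n => by
    rw [(hu _ _).1, (hu m n).1, doyleFrame_succ_right]; ring
  have hx := doyleRatio_ne_zero x
  have hy := doyleRatio_ne_zero y
  have hi : (P.inner m n : ℂ) ≠ 0 := by exact_mod_cast h0
  have ho : (P.outer m n : ℂ) ≠ 0 := by exact_mod_cast hP.outer_ne_zero m n
  have hI := Complex.I_ne_zero
  have hI' : I * I = -1 := Complex.I_mul_I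
  -- After this shift, the four squares around the vertex are expressed through the single direction
  -- `u k j`.
  obtain ⟨k, rfl⟩ : ∃ k, m = k + 1 := ⟨m - 1, by ring⟩
  obtain ⟨j, rfl⟩ : ∃ j, n = j + 1 := ⟨n - 1, by ring⟩
  have e1 : P.touch (k + 1) (j + 1) - P.center (k + 1) (j + 1) =
      P.inner (k + 1) (j + 1) * (doyleRatio x * (doyleRatio y * u k j)) := by
    rw [h.lower_left (k + 1) (j + 1), ← hl, ← hv]; ring
  have e2 : P.touch (k + 1) j - P.center (k + 1) (j + 1) =
      -I * P.outer (k + 1) (j + 1) * (doyleRatio y * u k j) := by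
    rw [h.upper_left (k + 1) j, ← hl]; ring
  have e3 : P.touch k (j + 1) - P.center (k + 1) (j + 1) =
      I * P.outer (k + 1) (j + 1) * (doyleRatio x * u k j) := by
    rw [h.lower_right k (j + 1), ← hv]; ring
  have e4 : P.touch k j - P.center (k + 1) (j + 1) = -P.inner (k + 1) (j + 1) * u k j := by
    rw [h.upper_right k j]; ring
  have hk := hune k j
  refine ⟨?_, ?_, ?_, ?_⟩
  · rw [angleEast, angleAt, add_sub_cancel_right, e1, e2]
    congr 1; push_cast; field_simp
    linear_combination -hI'
  · rw [angleWest, angleAt, add_sub_cancel_right, add_sub_cancel_right, e3, e4, doyleRatio_neg]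
    congr 1; push_cast; field_simp
    linear_combination -hI'
  · rw [angleNorth, angleAt, add_sub_cancel_right, e1, e3, doyleRatio_neg]
    congr 1; push_cast; field_simp
  · rw [angleSouth, angleAt, add_sub_cancel_right, add_sub_cancel_right, e2, e4]
    congr 1; push_cast; field_simp

theorem IsOrthogonalRingPattern.angles_of_pos (hxy : (x : ℂ) + y * I ≠ 0) (hℓ : 0 < ℓ)
    (hP : P.IsOrthogonalRingPattern) (hr : P.HasRhoRadii ℓ (fun m n => doyleRho x y m n + δ))
    {m n : ℤ} (h : 0 < doyleRho x y m n + δ) :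
    P.angleEast m n = Real.pi - 2 * Real.arctan (Real.exp (-x)) ∧
    P.angleWest m n = Real.pi - 2 * Real.arctan (Real.exp x) ∧
    P.angleNorth m n = Real.pi - 2 * Real.arctan (Real.exp y) ∧
    P.angleSouth m n = Real.pi - 2 * Real.arctan (Real.exp (-y)) := by
  have hi : 0 < P.inner m n := by rw [(hr m n).2]; exact mul_pos hℓ (Real.sinh_pos_iff.2 h)
  have ho : 0 < P.outer m n := by rw [(hr m n).1]; exact mul_pos hℓ (Real.cosh_pos _)
  obtain ⟨h1, h2, h3, h4⟩ := hP.angles_eq hxy hr m n hi.ne'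
  rw [h1, h2, h3, h4]
  simp only [arg_mul_I_mul_doyleRatio_of_pos (div_pos hi ho),
    arg_mul_I_mul_doyleRatio_of_pos (div_pos ho hi), neg_neg, and_self]

theorem IsOrthogonalRingPattern.angles_of_neg (hxy : (x : ℂ) + y * I ≠ 0) (hℓ : 0 < ℓ)
    (hP : P.IsOrthogonalRingPattern) (hr : P.HasRhoRadii ℓ (fun m n => doyleRho x y m n + δ))
    {m n : ℤ} (h : doyleRho x y m n + δ < 0) :
    P.angleEast m n = -2 * Real.arctan (Real.exp (-x)) ∧
    P.angleWest m n = -2 * Real.arctan (Real.exp x) ∧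
    P.angleNorth m n = -2 * Real.arctan (Real.exp y) ∧
    P.angleSouth m n = -2 * Real.arctan (Real.exp (-y)) := by
  have hi : P.inner m n < 0 := by
    rw [(hr m n).2]; exact mul_neg_of_pos_of_neg hℓ (Real.sinh_neg_iff.2 h)
  have ho : 0 < P.outer m n := by rw [(hr m n).1]; exact mul_pos hℓ (Real.cosh_pos _)
  obtain ⟨h1, h2, h3, h4⟩ := hP.angles_eq hxy hr m n hi.ne
  rw [h1, h2, h3, h4]
  simp only [arg_mul_I_mul_doyleRatio_of_neg (div_neg_of_neg_of_pos hi ho),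
    arg_mul_I_mul_doyleRatio_of_neg (div_neg_of_pos_of_neg ho hi), neg_neg, and_self]

end RingSystem

/-! ### Limits of the deformation -/

/-- For `δ ≥ 0` the scaling makes the coefficient of `g` equal to `1` and that of `h` equal to
`e^(-2δ)`. -/
theorem tendsto_superposition_atTop {V : Type*} [NormedAddCommGroup V] [NormedSpace ℝ V]
    (g h : V) : Tendsto (fun δ : ℝ => (2 * Real.exp (-|δ|)) •
      ((1 / 2 * Real.exp δ) • g - (1 / 2 * Real.exp (-δ)) • h)) atTop (𝓝 g) := by
  have h0 : Tendsto (fun δ : ℝ => g - Real.exp (-(2 * δ)) • h) atTop (𝓝 (g - (0 : ℝ) • h)) :=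
    tendsto_const_nhds.sub (((Real.tendsto_exp_neg_atTop_nhds_zero).comp
      (tendsto_id.const_mul_atTop two_pos)).smul_const h)
  rw [zero_smul, sub_zero] at h0
  refine h0.congr' ?_
  filter_upwards [eventually_ge_atTop 0] with δ hδ
  rw [abs_of_nonneg hδ, smul_sub, smul_smul, smul_smul]
  have e1 : Real.exp (-δ) * Real.exp δ = 1 := by rw [← Real.exp_add]; simp
  have e2 : Real.exp (-(2 * δ)) = Real.exp (-δ) * Real.exp (-δ) := by
    rw [← Real.exp_add]; ring_nf
  rw [show 2 * Real.exp (-δ) * (1 / 2 * Real.exp δ) = 1 by linear_combination e1,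
    show 2 * Real.exp (-δ) * (1 / 2 * Real.exp (-δ)) = Real.exp (-(2 * δ)) by rw [e2]; ring,
    one_smul]

/-- The substitution `δ ↦ -δ` exchanges `(g, h)` with `(-h, -g)`. -/
theorem tendsto_superposition_atBot {V : Type*} [NormedAddCommGroup V] [NormedSpace ℝ V]
    (g h : V) : Tendsto (fun δ : ℝ => (2 * Real.exp (-|δ|)) •
      ((1 / 2 * Real.exp δ) • g - (1 / 2 * Real.exp (-δ)) • h)) atBot (𝓝 (-h)) := by
  have := (tendsto_superposition_atTop (-h) (-g)).comp tendsto_neg_atBot_atTop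
  refine this.congr fun δ => ?_
  simp only [Function.comp, abs_neg, neg_neg, smul_neg]
  congr 1; abel

/-- The Doyle spiral ring pattern converges, if its center, radii and touching points converge
before normalization. -/
theorem converges_scale_normalize {F : ℝ → RingSystem} {l : Filter ℝ} {s : ℝ → ℝ} {Q : RingSystem}
    (hs : ∀ δ, 0 < s δ) (h : RingSystem.Converges (fun δ => (F δ).scale (s δ)) l Q)
    (h0 : Q.center 1 0 - Q.center 0 0 ≠ 0) :
    RingSystem.Converges (fun δ => (F δ).normalize.scale (s δ)) l Q.normalize := by
  have hu := (continuousAt_unitConj h0).tendsto.comp ((h 1 0).1.sub (h 0 0).1)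
  intro m n
  obtain ⟨h1, h2, h3, h4⟩ := h m n
  refine ⟨(hu.mul (h1.sub (h 0 0).1)).congr fun δ => ?_, h2, h3,
    (hu.mul (h4.sub (h 0 0).1)).congr fun δ => ?_⟩
  all_goals
    simp only [Function.comp, RingSystem.scale, RingSystem.normalize, ← mul_sub,
      unitConj_ofReal_mul (hs δ)]
    ring

theorem continuousFamily_normalize {F : ℝ → RingSystem} (h : RingSystem.ContinuousFamily F)
    (h0 : ∀ δ, (F δ).center 1 0 - (F δ).center 0 0 ≠ 0) :
    RingSystem.ContinuousFamily (fun δ => (F δ).normalize) := by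
  have hu : Continuous fun δ => unitConj ((F δ).center 1 0 - (F δ).center 0 0) :=
    continuous_iff_continuousAt.2 fun δ => (continuousAt_unitConj (h0 δ)).comp
      (f := fun δ => (F δ).center 1 0 - (F δ).center 0 0)
      ((h 1 0).1.sub (h 0 0).1).continuousAt
  intro m n
  obtain ⟨h1, h2, h3, h4⟩ := h m n
  exact ⟨hu.mul (h1.sub (h 0 0).1), h2, h3, hu.mul (h4.sub (h 0 0).1)⟩

theorem continuousFamily_doyleRing (x y ℓ : ℝ) :
    RingSystem.ContinuousFamily (doyleRing x y ℓ) := by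
  intro m n
  refine ⟨?_, ?_, ?_, ?_⟩ <;> simp only [doyleRing]
  · fun_prop
  · exact continuous_const.mul (Real.continuous_sinh.comp (by fun_prop))
  · exact continuous_const.mul (Real.continuous_cosh.comp (by fun_prop))
  · fun_prop

/-- Together with its `cosh` analogue, this brings the radii into the same superposition form as the
centres, so that one limit lemma serves all four quantities. -/
theorem sinh_doyleRho_add (x y δ : ℝ) (m n : ℤ) :
    1 * Real.sinh (doyleRho x y m n + δ) = (1 / 2 * Real.exp δ) • doyleRadius x y m n -
      (1 / 2 * Real.exp (-δ)) • doyleRadius (-x) (-y) m n := by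
  simp only [Real.sinh_eq, doyleRadius, doyleRho_neg, neg_add, Real.exp_add, smul_eq_mul]
  ring

theorem cosh_doyleRho_add (x y δ : ℝ) (m n : ℤ) :
    1 * Real.cosh (doyleRho x y m n + δ) = (1 / 2 * Real.exp δ) • doyleRadius x y m n -
      (1 / 2 * Real.exp (-δ)) • -doyleRadius (-x) (-y) m n := by
  simp only [Real.cosh_eq, doyleRadius, doyleRho_neg, neg_add, Real.exp_add, smul_eq_mul]
  ring

theorem converges_doyleRing_atTop (x y : ℝ) :
    RingSystem.Converges (fun δ => (doyleRing x y 1 δ).scale (2 * Real.exp (-|δ|))) atTop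
      ⟨doyleCenter x y, doyleRadius x y, doyleRadius x y, doyleTouch x y⟩ := by
  intro m n
  simp only [RingSystem.scale, doyleRing, sinh_doyleRho_add, cosh_doyleRho_add,
    ← Complex.real_smul]
  exact ⟨tendsto_superposition_atTop _ _, tendsto_superposition_atTop _ _,
    tendsto_superposition_atTop _ _, tendsto_superposition_atTop _ _⟩

theorem converges_doyleRing_atBot (x y : ℝ) :
    RingSystem.Converges (fun δ => (doyleRing x y 1 δ).scale (2 * Real.exp (-|δ|))) atBot
      ⟨fun m n => -(starRingEnd ℂ) (doyleCenter (-x) (-y) m n),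
        fun m n => -doyleRadius (-x) (-y) m n, fun m n => -(-doyleRadius (-x) (-y) m n),
        fun m n => -(starRingEnd ℂ) (doyleTouch (-x) (-y) m n)⟩ := by
  intro m n
  simp only [RingSystem.scale, doyleRing, sinh_doyleRho_add, cosh_doyleRho_add,
    ← Complex.real_smul]
  exact ⟨tendsto_superposition_atBot _ _, tendsto_superposition_atBot _ _,
    tendsto_superposition_atBot _ _, tendsto_superposition_atBot _ _⟩

theorem doyleSpiral_isDoyleSpiral {x y : ℝ} (hxy : (x : ℂ) + y * I ≠ 0) {a : ℂ} (ha : ‖a‖ = 1) :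
    (doyleSpiral a x y).IsDoyleSpiral x y := by
  refine ⟨doyleSpiral_isOrthogonalCirclePattern hxy ha, fun m n => ?_⟩
  rw [Complex.norm_exp]
  change Real.exp _ = _
  congr 1
  simp [doyleRho]; ring

theorem doyleSpiral_isDual {x y : ℝ} (hxy : (x : ℂ) + y * I ≠ 0) {a b : ℂ} (ha : ‖a‖ = 1)
    (hb : ‖b‖ = 1) : (doyleSpiral b (-x) (-y)).IsDual (doyleSpiral a x y) := by
  refine ⟨doyleSpiral_isOrthogonalCirclePattern (neg_ne_zero_of_ne_zero hxy) hb,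
    doyleSpiral_isOrthogonalCirclePattern hxy ha, fun m n => ?_⟩
  change Real.exp _ = (Real.exp _)⁻¹
  rw [doyleRho_neg, Real.exp_neg]

theorem toRings_doyleSpiral (x y : ℝ) :
    (doyleSpiral (unitConj (doyleCenter x y 1 0 - doyleCenter x y 0 0)) x y).toRings =
      RingSystem.normalize
        ⟨doyleCenter x y, doyleRadius x y, doyleRadius x y, doyleTouch x y⟩ := rfl

/-- The rotation of the spiral is chosen so that its conjugate, which acts after reflection, absorbs
both the normalizing rotation and the minus sign of the limit at `-∞`. -/
theorem toReversedRings_doyleSpiral (x y : ℝ) :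
    (doyleSpiral (-(starRingEnd ℂ) (unitConj (-(starRingEnd ℂ) (doyleCenter x y 1 0) -
      -(starRingEnd ℂ) (doyleCenter x y 0 0)))) x y).toReversedRings =
      RingSystem.normalize ⟨fun m n => -(starRingEnd ℂ) (doyleCenter x y m n),
        fun m n => -doyleRadius x y m n, fun m n => -(-doyleRadius x y m n),
        fun m n => -(starRingEnd ℂ) (doyleTouch x y m n)⟩ := by
  ext m n
  · simp only [CircleSystem.toReversedRings, doyleSpiral, RingSystem.normalize, map_mul, map_neg,
      map_sub, Complex.conj_conj]
    ring
  · rfl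
  · exact (neg_neg _).symm
  · simp only [CircleSystem.toReversedRings, doyleSpiral, RingSystem.normalize, map_mul, map_neg,
      map_sub, Complex.conj_conj]
    ring

theorem exists_limits_doyleRing {x y : ℝ} (hxy : (x : ℂ) + y * I ≠ 0) :
    ∃ C D : CircleSystem, C.IsDoyleSpiral x y ∧ D.IsDual C ∧
      RingSystem.Converges (fun δ => (doyleRing x y 1 δ).normalize.scale (2 * Real.exp (-|δ|)))
        atTop C.toRings ∧
      RingSystem.Converges (fun δ => (doyleRing x y 1 δ).normalize.scale (2 * Real.exp (-|δ|)))
        atBot D.toReversedRings := by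
  have hs : ∀ δ : ℝ, 0 < 2 * Real.exp (-|δ|) := fun δ => by positivity
  have h₁ := doyleCenter_ne hxy
  have h₂ : -(starRingEnd ℂ) (doyleCenter (-x) (-y) 1 0) -
      -(starRingEnd ℂ) (doyleCenter (-x) (-y) 0 0) ≠ 0 := by
    have := doyleCenter_ne (neg_ne_zero_of_ne_zero hxy)
    rw [← map_ne_zero (starRingEnd ℂ), map_sub] at this
    intro h; apply this; linear_combination -h
  have hb := norm_unitConj h₂
  rw [← RCLike.norm_conj, ← norm_neg] at hb
  refine ⟨_, _, doyleSpiral_isDoyleSpiral hxy (norm_unitConj h₁),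
    doyleSpiral_isDual hxy (norm_unitConj h₁) hb, ?_, ?_⟩
  · rw [toRings_doyleSpiral]
    exact converges_scale_normalize (Q := ⟨_, _, _, _⟩) hs (converges_doyleRing_atTop x y) h₁
  · rw [toReversedRings_doyleSpiral]
    exact converges_scale_normalize (Q := ⟨_, _, _, _⟩) hs (converges_doyleRing_atBot x y) h₂

theorem proposition1 (x y : ℝ) (hxy : (x : ℂ) + (y : ℂ) * Complex.I ≠ 0) :
    -- the radii define a ring pattern, uniquely up to motions, together with its deformations
    (∀ ℓ : ℝ, 0 < ℓ → ∀ δ : ℝ,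
      (∃ P : RingSystem, P.IsOrthogonalRingPattern ∧ P.Normalized ∧
        P.HasRhoRadii ℓ (fun m n => doyleRho x y m n + δ)) ∧
      (∀ P Q : RingSystem, P.IsOrthogonalRingPattern → Q.IsOrthogonalRingPattern →
        P.HasRhoRadii ℓ (fun m n => doyleRho x y m n + δ) →
        Q.HasRhoRadii ℓ (fun m n => doyleRho x y m n + δ) → P.Congruent Q)) ∧
    -- the angles of the quadrilaterals are constant in each half-plane
    (∀ ℓ : ℝ, 0 < ℓ → ∀ δ : ℝ, ∀ P : RingSystem, P.IsOrthogonalRingPattern →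
      P.HasRhoRadii ℓ (fun m n => doyleRho x y m n + δ) →
      ∀ m n : ℤ,
        ((n : ℝ) * y < m * x + δ →
          P.angleEast m n = Real.pi - 2 * Real.arctan (Real.exp (-x)) ∧
          P.angleWest m n = Real.pi - 2 * Real.arctan (Real.exp x) ∧
          P.angleNorth m n = Real.pi - 2 * Real.arctan (Real.exp y) ∧
          P.angleSouth m n = Real.pi - 2 * Real.arctan (Real.exp (-y))) ∧
        ((m : ℝ) * x + δ < n * y →
          P.angleEast m n = -2 * Real.arctan (Real.exp (-x)) ∧
          P.angleWest m n = -2 * Real.arctan (Real.exp x) ∧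
          P.angleNorth m n = -2 * Real.arctan (Real.exp y) ∧
          P.angleSouth m n = -2 * Real.arctan (Real.exp (-y)))) ∧
    -- the deformation of rings of area `π` interpolates between the Doyle spiral and its dual
    (∀ P : ℝ → RingSystem,
      (∀ δ : ℝ, (P δ).IsOrthogonalRingPattern ∧ (P δ).Normalized ∧
        (P δ).HasRhoRadii 1 (fun m n => doyleRho x y m n + δ)) →
      RingSystem.ContinuousFamily P ∧
      ∃ C D : CircleSystem, C.IsDoyleSpiral x y ∧ D.IsDual C ∧
        RingSystem.Converges (fun δ => (P δ).scale (2 * Real.exp (-|δ|))) Filter.atTop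
          C.toRings ∧
        RingSystem.Converges (fun δ => (P δ).scale (2 * Real.exp (-|δ|))) Filter.atBot
          D.toReversedRings) := by
  refine ⟨fun ℓ hℓ δ => ⟨RingSystem.exists_doyleRing hxy hℓ δ, fun P Q hP hQ hrP hrQ => ?_⟩,
    fun ℓ hℓ δ P hP hr m n => ⟨fun h => ?_, fun h => ?_⟩, fun P hP => ?_⟩
  · exact hP.congruent hQ (hrQ.inner_eq.trans hrP.inner_eq.symm)
      (hrQ.outer_eq.trans hrP.outer_eq.symm)
  · exact hP.angles_of_pos hxy hℓ hr (by simp only [doyleRho]; linarith)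
  · exact hP.angles_of_neg hxy hℓ hr (by simp only [doyleRho]; linarith)
  -- A normalized pattern is unique, so the given family is the explicit one, and continuity and
  -- limits can be read off from formulas.
  · obtain rfl : P = fun δ => (doyleRing x y 1 δ).normalize := funext fun δ =>
      (hP δ).1.eq_normalize_doyleRing hxy (hP δ).2.1 (hP δ).2.2
    exact ⟨continuousFamily_normalize (continuousFamily_doyleRing x y 1)
      (doyleRing_center_ne hxy one_pos), exists_limits_doyleRing hxy⟩
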